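/- Let $M_{\mathbb R}=\{x\in\mathbb R^5:\sum_i x_i=0\}$ and let $N_{\mathbb R}$ be its dual space, with pairing $\langle m,n\rangle$; let $n^i\in N_{\mathbb R}$ be the $i$-th coordinate functional. A monomial $z^a=z_1^{a_1}\cdots z_5^{a_5}$ of degree $5$ is identified with the point $(a_1-1,\dots,a_5-1)$ of $M_{\mathbb R}$. Let $\Delta=\{x\in M_{\mathbb R}: x_i\ge -1\ \forall i\}$ be the Newton polyhedron of quintic polynomials, and let $\Delta^\vee=\{n:\langle m,n\rangle\ge-1\ \forall m\in\Delta\}$, a simplex with vertices $n^1,\dots,n^5$. Let $\mathrm{sk}_2\Delta$ be the two-skeleton of $\Delta$, and let $\Delta^0$ be its (finite) set of integral points. Let $Z$ be a simplicial decomposition of $\mathrm{sk}_2\Delta$ whose vertices are exactly the points of $\Delta^0$. Let $w=(w_m)_{m\in\Delta^0}$ be positive real numbers that are convex with respect to $\Delta^0$ and determine $Z$, that is: for each simplex $\sigma$ of $Z$ there is a linear function $n$ on $M_{\mathbb R}$ with $n(m)=w_m$ for the vertices $m$ of $\sigma$ and $n(m)<w_m$ for all other $m\in\Delta^0$. Put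 $$\Delta_w=\{n\in N_{\mathbb R}:\langle m,n\rangle\ge -w_m\ \ \forall m\in\Delta^0\},\qquad \Delta_w^\vee=\{m\in M_{\mathbb R}:\langle m,n\rangle\ge-1\ \ \forall n\in\Delta_w\}.$$ For a proper face $\alpha$ of $\Delta_w$ let $\alpha^*=\{m\in\Delta_w^\vee:\langle m,n\rangle=-1\ \forall n\in\alpha\}$ be the dual face. The barycenter $\hat\alpha$ of a polytope $\alpha$ is the average of its vertices, and barycentric subdivisions are taken with respect to these points. The graph $\Gamma'_Z\subset\partial\Delta_w$ (the singular locus for the mirror) is the union of those $1$-simplices of the barycentric subdivision of the two-skeleton of $\Delta_w$ whose image under $\pi$ contains no vertex of $\Delta^\vee$. Here $\pi:\Delta_w\to\Delta^\vee$ is the map induced by the toric blow-down, $$\pi(n)=\frac{\sum_{i=1}^5 s_i(n)\,n^i}{s_0(n)+\sum_{i=1}^5 s_i(n)},\qquad s_i(n)=\prod_{m\in\Delta^0}\bigl(\langle m,n\rangle+w_m\bigr)^{\langle m,n^i\rangle+1},\qquad s_0(n)=\prod_{m\in\Delta^0}\bigl(\langle m,n\rangle+w_m\bigr).$$ The graph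 $\Gamma_Z\subset\mathrm{sk}_2\Delta$ (the singular locus for the quintic) is the union of the simplices of the barycentric subdivision of $Z$ that have no point of $\Delta^0$ as a vertex. Let $h:\mathrm{sk}_2\Delta\to\partial\Delta_w^\vee$ be the map that is linear on each simplex of $Z$ and sends $m$ to $w_m^{-1}m$ for $m\in\Delta^0$; the image $h(\Gamma_Z)$ is again called $\Gamma_Z$. **Theorem.** There is a piecewise linear homeomorphism $s:\partial\Delta_w\to\partial\Delta_w^\vee$ induced by the dual-face barycentric correspondence: the simplices $\mathrm{conv}\{\hat\alpha_0,\dots,\hat\alpha_k\}$, for flags $\alpha_0\subsetneq\dots\subsetneq\alpha_k$ of nonempty proper faces of $\Delta_w$, lie in and cover $\partial\Delta_w$, and $s$ maps each of them linearly onto $\mathrm{conv}\{\widehat{\alpha_0^*},\dots,\widehat{\alpha_k^*}\}$ with $s(\hat\alpha_j)=\widehat{\alpha_j^*}$. Moreover $\Gamma'_Z\subset\partial\Delta_w$ and $s(\Gamma'_Z)=h(\Gamma_Z)=\Gamma_Z$. -/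

import Mathlib

open scoped BigOperators

noncomputable section

namespace QuinticMirror

/-! ### Polyhedra in a real topological vector space -/

section Polyhedra

variable {E F : Type*} [AddCommGroup E] [Module ℝ E] [TopologicalSpace E]
  [AddCommGroup F] [Module ℝ F] [TopologicalSpace F]

/-- `A` is a nonempty face of the polyhedron `P`, different from `P` itself. -/
def IsProperFace (P A : Set E) : Prop :=
  A.Nonempty ∧ A ≠ P ∧ IsExposed ℝ P A

/-- The dimension of (the affine hull of) a set. -/
def faceDim (A : Set E) : ℕ :=
  Module.finrank ℝ (vectorSpan ℝ A)

/-- The barycenter of a polytope: the average of its vertices. -/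
def barycenter (A : Set E) : E :=
  ((A.extremePoints ℝ).ncard : ℝ)⁻¹ • ∑ᶠ x ∈ A.extremePoints ℝ, x

/-- A finite nonempty flag of proper faces of `P`. The points `barycenter A`, `A ∈ c`, are
the vertices of a simplex of the barycentric subdivision of the boundary of `P`. -/
def IsFlag (P : Set E) (c : Finset (Set E)) : Prop :=
  c.Nonempty ∧ (∀ A ∈ c, IsProperFace P A) ∧ IsChain (· ⊆ ·) (c : Set (Set E))

/-- A homeomorphism is piecewise linear if its source is a finite union of convex polytopes,
on each of which it is the restriction of an affine map. -/
def IsPiecewiseLinear {A : Set E} {B : Set F} (s : A ≃ₜ B) : Prop :=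
  ∃ pieces : Set (Set E), pieces.Finite ∧ (∀ P ∈ pieces, ∃ t : Finset E, P = convexHull ℝ (t : Set E)) ∧
    ⋃₀ pieces = A ∧
    ∀ P ∈ pieces, ∃ g : E →ᵃ[ℝ] F, ∀ x : A, (x : E) ∈ P → (s x : F) = g x

end Polyhedra

/-! ### The lattices, their real extensions, and the Newton polyhedron -/

/-- The real hyperplane of vectors in `ℝ⁵` with vanishing coordinate sum. -/
def sumZero : Submodule ℝ (Fin 5 → ℝ) where
  carrier := {x | ∑ i, x i = 0}
  add_mem' := by
    intro a b ha hb
    simp only [Set.mem_ofPred_eq, Pi.add_apply, Finset.sum_add_distrib] at *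
    rw [ha, hb, add_zero]
  zero_mem' := by simp
  smul_mem' := by
    intro c x hx
    simp only [Set.mem_ofPred_eq, Pi.smul_apply, smul_eq_mul, ← Finset.mul_sum] at *
    rw [hx, mul_zero]

/-- `M ⊗ ℝ`. The exponent `(1,1,1,1,1)` is the origin. -/
abbrev MR : Type := sumZero

/-- `N ⊗ ℝ`, the dual space of `M ⊗ ℝ`; the pairing `⟨m, n⟩` is `n m`. -/
abbrev NR : Type := StrongDual ℝ MR

/-- The vertex `nⁱ = [eⁱ]` of the simplex dual to the Newton polyhedron. -/
def nVertex (i : Fin 5) : NR :=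
  (ContinuousLinearMap.proj i : (Fin 5 → ℝ) →L[ℝ] ℝ).comp sumZero.subtypeL

/-- The Newton polyhedron `Δ` of quintic polynomials: exponents are nonnegative. -/
def Delta : Set MR := {m | ∀ i, -1 ≤ m.1 i}

/-- The two-skeleton of `Δ`: at least two exponents vanish. -/
def twoSkeleton : Set MR :=
  {m | m ∈ Delta ∧ ∃ i j, i ≠ j ∧ m.1 i = -1 ∧ m.1 j = -1}

/-- The exponents of the quintic monomials in the two-skeleton of `Δ`. -/
def skeletonExponents : Finset (Fin 5 → ℕ) :=
  (Finset.piAntidiag Finset.univ 5).filter (fun a => ∃ i j, i ≠ j ∧ a i = 0 ∧ a j = 0)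

/-- The set `Δ⁰` of integral points of the two-skeleton, as a finite index type. -/
abbrev Delta0 : Type := skeletonExponents

/-- The integral point of `M` given by a monomial of `Δ⁰`. -/
def pt (a : Delta0) : MR :=
  ⟨fun i => (a.1 i : ℝ) - 1, by
    have h : ∑ i, a.1 i = 5 := by
      have := (Finset.mem_filter.1 a.2).1
      simpa using this
    have h' : ∑ i, (a.1 i : ℝ) = 5 := by exact_mod_cast h
    change ∑ i, ((a.1 i : ℝ) - 1) = 0
    rw [Finset.sum_sub_distrib, h']
    simp⟩

/-- The polyhedron in `N ⊗ ℝ` dual to a polyhedron in `M ⊗ ℝ`. -/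
def dualInN (P : Set MR) : Set NR := {n | ∀ m ∈ P, -1 ≤ n m}

/-- The polyhedron in `M ⊗ ℝ` dual to a polyhedron in `N ⊗ ℝ`. -/
def dualInM (P : Set NR) : Set MR := {m | ∀ n ∈ P, -1 ≤ n m}

/-- The face of `dualInM P` dual to the face `A` of `P`. -/
def dualFace (P A : Set NR) : Set MR := {m | m ∈ dualInM P ∧ ∀ n ∈ A, n m = -1}

/-! ### Decompositions of the two-skeleton and compatible weights -/

/-- `Z` is a simplicial decomposition of the two-skeleton of `Δ` whose vertices are the
integral points of the two-skeleton. -/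
def IsIntegralDecomposition (Z : Geometry.SimplicialComplex ℝ MR) : Prop :=
  Z.space = twoSkeleton ∧ Z.vertices = Set.range pt

/-- `w`, as a piecewise linear function on the cones over the simplices of `Z`, is strictly
convex with respect to `Δ⁰`: each simplex of `Z` is cut out by a supporting linear function.
This is the condition that `w` is convex with respect to `Δ⁰` and that `Z` is the simplicial
decomposition determined by `w`. -/
def IsConvexCompatible (Z : Geometry.SimplicialComplex ℝ MR) (w : Delta0 → ℝ) : Prop :=
  ∀ σ ∈ Z.faces, ∃ n : NR, ∀ a : Delta0,
    (pt a ∈ σ → n (pt a) = w a) ∧ (pt a ∉ σ → n (pt a) < w a)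

/-! ### The polyhedron of the mirror and its singular locus graph -/

/-- The affine function `⟨m, ·⟩ + w_m`. -/
def ell (w : Delta0 → ℝ) (a : Delta0) (n : NR) : ℝ := n (pt a) + w a

/-- The polyhedron `Δ_w`. -/
def DeltaW (w : Delta0 → ℝ) : Set NR := {n | ∀ a, 0 ≤ ell w a n}

/-- The squared norm of the anticanonical section `nⁱ` in the homogeneous coordinates
`|z_m|² = ⟨m, ·⟩ + w_m`: the exponent of `z_m` is `⟨m, nⁱ⟩ + 1`, the `i`-th exponent of `m`. -/
def sectionN (w : Delta0 → ℝ) (i : Fin 5) (n : NR) : ℝ := ∏ a, ell w a n ^ a.1 i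

/-- The squared norm of the anticanonical section corresponding to the origin of `N`. -/
def sectionZero (w : Delta0 → ℝ) (n : NR) : ℝ := ∏ a, ell w a n

/-- The map `π : Δ_w → Δ^∨` induced by the toric morphism from the variety of the normal fan of
`Δ_w` to the variety of the fan over the faces of `Δ`. A point of `Δ_w` is the moment map image
of the real torus orbit with homogeneous coordinates `|z_m|² = ⟨m, ·⟩ + w_m`; it is sent to the
moment map image `(∑ |s_n|² n) / (∑ |s_n|²)` of that orbit, where the anticanonical sections
`s_n = ∏ z_m ^ (⟨m, n⟩ + 1)` are indexed by the integral points `n = 0, n¹, …, n⁵` of `Δ^∨`. -/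
def blowdown (w : Delta0 → ℝ) (n : NR) : NR :=
  (sectionZero w n + ∑ i, sectionN w i n)⁻¹ • ∑ i, sectionN w i n • nVertex i

/-- The graph `Γ'_Z` in the boundary of `Δ_w`: the union of the 1-simplices of the barycentric
subdivision of the two-skeleton of `Δ_w` whose image under `π` contains no vertex of `Δ^∨`. -/
def GammaMirror (w : Delta0 → ℝ) : Set NR :=
  {x | ∃ A B : Set NR, IsProperFace (DeltaW w) A ∧ IsProperFace (DeltaW w) B ∧ A ⊂ B ∧
    faceDim B ≤ 2 ∧
    (∀ y ∈ segment ℝ (barycenter A) (barycenter B),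
      blowdown w y ∉ (dualInN Delta).extremePoints ℝ) ∧
    x ∈ segment ℝ (barycenter A) (barycenter B)}

/-! ### The singular locus graph of the quintic -/

/-- The graph `Γ_Z` in the two-skeleton of `Δ`: the union of the simplices of the barycentric
subdivision of `Z` that have no integral point of the two-skeleton as a vertex. -/
def GammaQuintic (Z : Geometry.SimplicialComplex ℝ MR) : Set MR :=
  {x | ∃ c : Finset (Finset MR), c.Nonempty ∧ (∀ σ ∈ c, σ ∈ Z.faces) ∧
    IsChain (· ⊆ ·) (c : Set (Finset MR)) ∧
    (∀ σ ∈ c, σ.centroid ℝ id ∉ Set.range pt) ∧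
    x ∈ convexHull ℝ ((fun σ : Finset MR => σ.centroid ℝ id) '' (c : Set (Finset MR)))}

/-- `t` are barycentric coordinates of `x` with respect to the vertices of a simplex of `Z`. -/
def IsBarycentricCoord (Z : Geometry.SimplicialComplex ℝ MR) (x : MR) (t : Delta0 → ℝ) : Prop :=
  (∀ a, 0 ≤ t a) ∧ ∑ a, t a = 1 ∧ ∑ a, t a • pt a = x ∧
    ∃ σ ∈ Z.faces, ∀ a, t a ≠ 0 → pt a ∈ σ

open Classical in
/-- The piecewise linear map `h` from the two-skeleton of `Δ` to the boundary of the dual of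
`Δ_w`: it sends each integral point `m` to `w_m⁻¹ m` and is linear on each simplex of `Z`. -/
def skeletonMap (Z : Geometry.SimplicialComplex ℝ MR) (w : Delta0 → ℝ) (x : MR) : MR :=
  if hx : ∃ t, IsBarycentricCoord Z x t then
    ∑ a, hx.choose a • ((w a)⁻¹ • pt a) else 0

/-! ### The dual-face barycentric correspondence -/

/-- `s` is the map induced by the dual-face correspondence: the barycentric simplices of the
flags of proper faces cover the boundary of `P`, and on each of them `s` is the linear map that
sends the barycenter of a face to the barycenter of the dual face. -/
def IsDualBarycentric {P : Set NR} (s : frontier P ≃ₜ frontier (dualInM P)) : Prop :=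
  (∀ x ∈ frontier P, ∃ c, IsFlag P c ∧
    x ∈ convexHull ℝ (barycenter '' (c : Set (Set NR)))) ∧
  ∀ c, IsFlag P c → ∀ t : Set NR → ℝ, (∀ A ∈ c, 0 ≤ t A) → ∑ A ∈ c, t A = 1 →
    ∃ hx : ∑ A ∈ c, t A • barycenter A ∈ frontier P,
      (s ⟨_, hx⟩ : MR) = ∑ A ∈ c, t A • barycenter (dualFace P A)

end QuinticMirror

end

open scoped BigOperators

noncomputable section

set_option linter.unusedSectionVars false

/-! A point `y` of `Δ_w` has an active set `active w y`, the integral points `m` with `⟨m, y⟩ =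
-w_m`. A proper face is determined by the active set at its barycenter, and inclusion of faces
reverses inclusion of active sets.

The homeomorphism is a general fact about compact polyhedra cut out by finitely many inequalities
`-1 ≤ f i`, which contain the origin in their interior. Coning from barycenters shows that the flag
simplices cover the boundary (`exists_flag_mem_convexHull`), and evaluating active constraints shows
that barycentric coordinates are unique (`eq_of_sum_barycenter_eq`). The graph of the dual-face
correspondence is a finite union of convex hulls, hence compact. It projects bijectively, hence
homeomorphically, to both boundaries (`exists_homeomorph_of_isFaceDuality`).

For the graphs, convexity of `w` makes every simplex of `Z` the active set of a face
(`exists_face_of_simplex`), and every nonempty active set lying in a two-face of `Δ` a simplex of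
`Z` (`active_image_mem_faces`). On the boundary the section `s_0` vanishes, and `s_i` survives
exactly when the `i`-th exponent of every active point is zero. At least one such `i` exists
(`exists_zero_of_active`), and the image under `π` is not a vertex exactly when there are two, that
is, when the active set is a simplex of `Z` (`blowdown_notMem_extremePoints_iff`). For such a face
the dimension is four minus the number of active points. So `Γ'_Z` consists of the segments for
pairs `A ⊂ B` whose active sets `T ⊃ S` satisfy: `T` is a simplex of `Z` and `S` has at least two
elements.

The vertices of the dual face are the `w_m⁻¹ m` with `m` active, so `s` sends such a segment to the
one joining the averages over `T` and `S`. The map `h` sends the barycenters of the simplices `T`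
and `S` of `Z` to the same averages. Both images are therefore `edgeTriangleGraph`; on the quintic
side this also uses that each edge of `Z` lies in a triangle (`exists_face_ssuperset`). -/

namespace QuinticMirror


/-! ### Faces of a polyhedron through active constraints, and the covering of its boundary by flag
simplices. -/

section Polytope

variable {E : Type*} [AddCommGroup E] [Module ℝ E] [TopologicalSpace E] {ι : Type*}

/-- The polyhedron cut out by the inequalities `-1 ≤ f i`. -/
def polyhedron (f : ι → StrongDual ℝ E) : Set E := {x | ∀ i, -1 ≤ f i x}

theorem convex_polyhedron (f : ι → StrongDual ℝ E) : Convex ℝ (polyhedron f) := by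
  intro x hx y hy a b ha hb hab i
  have h1 := mul_le_mul_of_nonneg_left (hx i) ha
  have h2 := mul_le_mul_of_nonneg_left (hy i) hb
  simp only [map_add, map_smul, smul_eq_mul]
  nlinarith

theorem isClosed_polyhedron (f : ι → StrongDual ℝ E) : IsClosed (polyhedron f) := by
  have : polyhedron f = ⋂ i, {x | -1 ≤ f i x} := by ext; simp [polyhedron]
  rw [this]
  exact isClosed_iInter fun i => isClosed_le continuous_const (f i).continuous

/-- A polyhedron contains a short segment in each direction that respects the active
constraints. -/
theorem exists_pos_add_smul_mem [Finite ι] (f : ι → StrongDual ℝ E) {x d : E}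
    (hx : x ∈ polyhedron f) (hd : ∀ i, f i x = -1 → 0 ≤ f i d) :
    ∃ ε : ℝ, 0 < ε ∧ x + ε • d ∈ polyhedron f := by
  have key : ∀ᶠ ε : ℝ in nhdsWithin 0 (Set.Ioi 0), ∀ i, -1 ≤ f i x + ε * f i d := by
    rw [Filter.eventually_all]
    intro i
    rcases (hx i).eq_or_lt with h | h
    · filter_upwards [self_mem_nhdsWithin] with ε hε
      have := mul_nonneg (le_of_lt hε) (hd i h.symm)
      linarith
    · have hc : Filter.Tendsto (fun ε : ℝ => f i x + ε * f i d) (nhds 0)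
          (nhds (f i x + 0 * f i d)) := by
        apply Continuous.tendsto; fun_prop
      have : -1 < f i x + 0 * f i d := by simpa using h
      filter_upwards [(hc.eventually_const_lt this).filter_mono nhdsWithin_le_nhds] with ε hε
      exact hε.le
  obtain ⟨ε, h1, h2⟩ := (key.and self_mem_nhdsWithin).exists
  exact ⟨ε, h2, fun i => by simpa using h1 i⟩

theorem exists_pos_sub_smul_mem [Finite ι] (f : ι → StrongDual ℝ E) {x z : E}
    (hx : x ∈ polyhedron f) (hz : ∀ i, f i x = -1 → f i z = -1) :
    ∃ ε : ℝ, 0 < ε ∧ x + ε • (x - z) ∈ polyhedron f :=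
  exists_pos_add_smul_mem f hx fun i hi => by simp [hi, hz i hi]

/-- Extreme points with the same active constraints coincide: each would lie on an open segment from
the other to a point slightly beyond itself. The finitely many sets of constraints thus bound their
number. -/
theorem finite_extremePoints_polyhedron [Finite ι] (f : ι → StrongDual ℝ E) :
    ((polyhedron f).extremePoints ℝ).Finite := by
  classical
  refine Set.Finite.of_finite_image (f := fun x => {i | f i x = -1}) (Set.toFinite _) ?_
  intro x hx z hz hxz
  have hxz' : ∀ i, f i x = -1 → f i z = -1 := fun i hi => by
    have : i ∈ {i | f i x = -1} := hi
    simp only at hxz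
    rwa [hxz] at this
  obtain ⟨ε, hε, hm⟩ := exists_pos_sub_smul_mem f hx.1 hxz'
  refine (hx.2 hz.1 hm ⟨ε / (1 + ε), 1 / (1 + ε), by positivity, by positivity, by field_simp; ring,
    ?_⟩).symm
  have h : (1 + ε) ≠ 0 := by positivity
  have : ((1 + ε) : ℝ)⁻¹ • ((1 + ε) • x) = x := inv_smul_smul₀ h x
  rw [← this]
  simp only [div_eq_inv_mul, mul_smul, ← smul_add]
  congr 1
  rw [smul_smul, inv_mul_cancel₀ h]
  module

section Compact

variable [IsTopologicalAddGroup E] [ContinuousSMul ℝ E] [T2Space E] [LocallyConvexSpace ℝ E]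

/-- A compact convex set with finitely many extreme points is their convex hull. -/
theorem convexHull_extremePoints_eq {A : Set E} (hA : IsCompact A) (hc : Convex ℝ A)
    (hf : (A.extremePoints ℝ).Finite) : convexHull ℝ (A.extremePoints ℝ) = A := by
  conv_rhs => rw [← closure_convexHull_extremePoints hA hc]
  exact (hf.isCompact_convexHull ℝ).isClosed.closure_eq.symm

theorem barycenter_eq {A : Set E} (hf : (A.extremePoints ℝ).Finite) :
    barycenter A = ∑ x ∈ hf.toFinset, ((hf.toFinset.card : ℝ)⁻¹) • x := by
  rw [barycenter, finsum_mem_eq_finite_toFinset_sum _ hf, Finset.smul_sum,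
    Set.ncard_eq_toFinset_card _ hf]

theorem map_barycenter {A : Set E} (hf : (A.extremePoints ℝ).Finite) (g : E →ₗ[ℝ] ℝ) :
    g (barycenter A) = ∑ x ∈ hf.toFinset, ((hf.toFinset.card : ℝ)⁻¹) * g x := by
  rw [barycenter_eq hf, map_sum]
  simp

theorem barycenter_mem {A : Set E} (hA : IsCompact A) (hc : Convex ℝ A) (hne : A.Nonempty)
    (hf : (A.extremePoints ℝ).Finite) : barycenter A ∈ A := by
  have hne' : hf.toFinset.Nonempty := by
    simpa using hA.extremePoints_nonempty hne
  rw [barycenter_eq hf]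
  refine hc.sum_mem (fun _ _ => by positivity) ?_ fun x hx => ((hf.mem_toFinset).1 hx).1
  have : (hf.toFinset.card : ℝ) ≠ 0 := by exact_mod_cast hne'.card_pos.ne'
  simp [this]

/-- A linear function that attains its minimum over a polytope at the barycenter is constant. -/
theorem eq_of_barycenter_eq {A : Set E} (hA : IsCompact A) (hc : Convex ℝ A)
    (hf : (A.extremePoints ℝ).Finite) (g : E →ₗ[ℝ] ℝ) {c : ℝ} (hg : ∀ x ∈ A, c ≤ g x)
    (hb : g (barycenter A) = c) : ∀ x ∈ A, g x = c := by
  intro x hx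
  have hne' : hf.toFinset.Nonempty := by
    simpa using hA.extremePoints_nonempty ⟨x, hx⟩
  have hpos : (0 : ℝ) < hf.toFinset.card := by exact_mod_cast hne'.card_pos
  rw [map_barycenter hf, ← Finset.mul_sum] at hb
  have hs : ∑ x ∈ hf.toFinset, (g x - c) = 0 := by
    rw [Finset.sum_sub_distrib, Finset.sum_const, nsmul_eq_mul, ← hb]
    field_simp
    ring
  have hv : ∀ v ∈ A.extremePoints ℝ, g v = c := fun v hv => by
    have := (Finset.sum_eq_zero_iff_of_nonneg
      (fun v hv => sub_nonneg.2 (hg v ((hf.mem_toFinset).1 hv).1))).1 hs v (hf.mem_toFinset.2 hv)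
    linarith
  rw [← convexHull_extremePoints_eq hA hc hf] at hx
  have hsub : convexHull ℝ (A.extremePoints ℝ) ⊆ {x | g x = c} :=
    convexHull_min hv ((convex_singleton c).linear_preimage g)
  exact hsub hx

variable [Finite ι] {f : ι → StrongDual ℝ E}

theorem IsProperFace.isCompact {P A : Set E} (hP : IsCompact P) (h : IsProperFace P A) :
    IsCompact A := h.2.2.isCompact hP

theorem IsProperFace.convex {P A : Set E} (hP : Convex ℝ P) (h : IsProperFace P A) :
    Convex ℝ A := h.2.2.convex hP

theorem IsProperFace.subset {P A : Set E} (h : IsProperFace P A) : A ⊆ P := h.2.2.subset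

theorem IsProperFace.finite_extremePoints {A : Set E} (h : IsProperFace (polyhedron f) A) :
    (A.extremePoints ℝ).Finite :=
  (finite_extremePoints_polyhedron f).subset h.2.2.isExtreme.extremePoints_subset_extremePoints

theorem IsProperFace.barycenter_mem (hK : IsCompact (polyhedron f)) {A : Set E}
    (h : IsProperFace (polyhedron f) A) : barycenter A ∈ A :=
  QuinticMirror.barycenter_mem (h.isCompact hK) (h.convex (convex_polyhedron f)) h.1
    h.finite_extremePoints

theorem IsProperFace.eq_of_barycenter (hK : IsCompact (polyhedron f)) {A : Set E}
    (h : IsProperFace (polyhedron f) A) (g : E →ₗ[ℝ] ℝ) {c : ℝ} (hg : ∀ x ∈ A, c ≤ g x)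
    (hb : g (barycenter A) = c) : ∀ x ∈ A, g x = c :=
  eq_of_barycenter_eq (h.isCompact hK) (h.convex (convex_polyhedron f)) h.finite_extremePoints g
    hg hb

/-- The constraints active at the barycenter of a face are active on the face. -/
theorem IsProperFace.active_of_mem (hK : IsCompact (polyhedron f)) {A : Set E}
    (h : IsProperFace (polyhedron f) A) {x : E} (hx : x ∈ A) {i : ι}
    (hi : f i (barycenter A) = -1) : f i x = -1 :=
  h.eq_of_barycenter hK (f i : E →ₗ[ℝ] ℝ) (fun _ hy => h.subset hy i) hi x hx

/-- A face consists of the points at which the constraints active at its barycenter are active. -/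
theorem IsProperFace.mem_iff (hK : IsCompact (polyhedron f)) {A : Set E}
    (h : IsProperFace (polyhedron f) A) {x : E} :
    x ∈ A ↔ x ∈ polyhedron f ∧ ∀ i, f i (barycenter A) = -1 → f i x = -1 := by
  refine ⟨fun hx => ⟨h.subset hx, fun i hi => h.active_of_mem hK hx hi⟩, fun ⟨hx, hi⟩ => ?_⟩
  have hb := h.barycenter_mem hK
  obtain ⟨ε, hε, hm⟩ := exists_pos_sub_smul_mem f (h.subset hb) hi
  obtain ⟨l, hl⟩ := h.2.2 h.1
  have hb' : barycenter A ∈ {x | x ∈ polyhedron f ∧ ∀ y ∈ polyhedron f, l y ≤ l x} := hl ▸ hb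
  have h1 := hb'.2 _ hm
  simp only [map_add, map_smul, map_sub, smul_eq_mul] at h1
  have h2 : l (barycenter A) ≤ l x := by nlinarith
  rw [hl]
  exact ⟨hx, fun y hy => (hb'.2 y hy).trans h2⟩

theorem IsProperFace.exists_active (hK : IsCompact (polyhedron f)) {A : Set E}
    (h : IsProperFace (polyhedron f) A) : ∃ i, f i (barycenter A) = -1 := by
  by_contra! hn
  refine h.2.1 (h.subset.antisymm fun x hx => (h.mem_iff hK).2 ⟨hx, fun i hi => (hn i hi).elim⟩)

/-- The face lattice is encoded, with order reversed, by the active sets at barycenters; finiteness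
of faces and flags follows. -/
theorem IsProperFace.subset_iff (hK : IsCompact (polyhedron f)) {A B : Set E}
    (hA : IsProperFace (polyhedron f) A) (hB : IsProperFace (polyhedron f) B) :
    A ⊆ B ↔ ∀ i, f i (barycenter B) = -1 → f i (barycenter A) = -1 := by
  refine ⟨fun h i hi => hB.active_of_mem hK (h (hA.barycenter_mem hK)) hi, fun h x hx => ?_⟩
  exact (hB.mem_iff hK).2 ⟨hA.subset hx, fun i hi => hA.active_of_mem hK hx (h i hi)⟩

theorem finite_properFaces (hK : IsCompact (polyhedron f)) :
    {A | IsProperFace (polyhedron f) A}.Finite := by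
  refine Set.Finite.of_finite_image (f := fun A => {i | f i (barycenter A) = -1})
    (Set.toFinite _) ?_
  intro A hA B hB hAB
  have h : ∀ i, f i (barycenter A) = -1 ↔ f i (barycenter B) = -1 := fun i => by
    simpa using Set.ext_iff.1 hAB i
  exact ((hA.subset_iff hK hB).2 fun i => (h i).2).antisymm
    ((hB.subset_iff hK hA).2 fun i => (h i).1)

theorem finite_flags (hK : IsCompact (polyhedron f)) :
    {c | IsFlag (polyhedron f) c}.Finite := by
  refine ((finite_properFaces hK).finite_subsets.preimage
    (f := fun c : Finset (Set E) => (c : Set (Set E)))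
    Finset.coe_injective.injOn).subset fun c hc => ?_
  exact fun A hA => hc.2.1 A hA

/-- The origin satisfies every inequality strictly, so scaling a point outwards violates an active
one. Conversely the finitely many strict inequalities cut out an open set. -/
theorem mem_frontier_polyhedron {x : E} :
    x ∈ frontier (polyhedron f) ↔ x ∈ polyhedron f ∧ ∃ i, f i x = -1 := by
  rw [(isClosed_polyhedron f).frontier_eq, Set.mem_sdiff]
  refine and_congr_right fun hx => ?_
  rw [← not_iff_not]
  push Not
  constructor
  · intro h i hi
    have hc : Filter.Tendsto (fun ε : ℝ => x + ε • x) (nhds 0) (nhds (x + (0 : ℝ) • x)) := by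
      apply Continuous.tendsto; fun_prop
    simp only [zero_smul, add_zero] at hc
    have h1 := hc.eventually (mem_interior_iff_mem_nhds.1 h)
    obtain ⟨ε, h1, h2⟩ := ((h1.filter_mono nhdsWithin_le_nhds).and
      (self_mem_nhdsWithin : Set.Ioi (0 : ℝ) ∈ nhdsWithin 0 (Set.Ioi 0))).exists
    have := h1 i
    simp only [map_add, map_smul, smul_eq_mul, hi] at this
    have h2 : 0 < ε := h2
    linarith
  · intro h
    have ho : IsOpen (⋂ i, {x | -1 < f i x}) :=
      isOpen_iInter_of_finite fun i => isOpen_lt continuous_const (f i).continuous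
    refine interior_maximal (fun y hy i => ?_) ho
      (Set.mem_iInter.2 fun i => (hx i).lt_of_ne (h i).symm)
    exact (Set.mem_iInter.1 hy i).le

/-- The smallest face containing a point of the boundary. -/
def carrierFace (f : ι → StrongDual ℝ E) (x : E) : Set E :=
  {z | z ∈ polyhedron f ∧ ∀ i, f i x = -1 → f i z = -1}

theorem isProperFace_carrierFace {x : E} (hx : x ∈ frontier (polyhedron f)) :
    IsProperFace (polyhedron f) (carrierFace f x) := by
  classical
  have := Fintype.ofFinite ι
  obtain ⟨hx, i, hi⟩ := mem_frontier_polyhedron.1 hx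
  refine ⟨⟨x, hx, fun _ => id⟩, fun h => ?_, fun _ => ?_⟩
  · have h0 : (0 : E) ∈ carrierFace f x := by
      rw [h]; intro j; simp
    have := h0.2 i hi
    simp at this
  -- Minus the sum of the active constraints is maximal exactly where each of them attains its least
  -- value `-1`.
  · refine ⟨-∑ i with f i x = -1, f i, ?_⟩
    have key : ∀ y : E, (-∑ i with f i x = -1, f i) y = -∑ i with f i x = -1, f i y := by
      intro y; simp
    ext z
    simp only [carrierFace, Set.mem_ofPred_eq, key, neg_le_neg_iff]
    refine and_congr_right fun hz => ⟨fun h y hy => ?_, fun h => ?_⟩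
    · exact Finset.sum_le_sum fun j hj => by
        rw [h j (Finset.mem_filter.1 hj).2]; exact hy j
    · have h1 := h x hx
      have h2 : ∑ i with f i x = -1, (f i z - f i x) ≤ 0 := by
        rw [Finset.sum_sub_distrib]; linarith
      have hnn : ∀ j ∈ Finset.univ.filter (fun i => f i x = -1), 0 ≤ f j z - f j x :=
        fun j hj => by rw [(Finset.mem_filter.1 hj).2]; linarith [hz j]
      have h3 := (Finset.sum_eq_zero_iff_of_nonneg hnn).1
        (le_antisymm h2 (Finset.sum_nonneg hnn))
      intro j hj
      have := h3 j (by simpa using hj)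
      linarith

theorem active_barycenter_carrierFace (hK : IsCompact (polyhedron f)) {x : E}
    (hx : x ∈ frontier (polyhedron f)) (i : ι) :
    f i (barycenter (carrierFace f x)) = -1 ↔ f i x = -1 := by
  have hF := isProperFace_carrierFace hx
  refine ⟨fun h => hF.active_of_mem hK ⟨(mem_frontier_polyhedron.1 hx).1, fun _ => id⟩ h,
    fun h => (hF.barycenter_mem hK).2 i h⟩

/-- From a point with the same active constraints one can move away from `b` until a further
constraint becomes active. -/
theorem exists_ray_exit (hK : IsCompact (polyhedron f)) {x b : E} (hx : x ∈ polyhedron f)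
    (hxb : x ≠ b) (hact : ∀ i, f i x = -1 → f i b = -1) :
    ∃ z ∈ polyhedron f, x ∈ segment ℝ b z ∧ (∀ i, f i x = -1 → f i z = -1) ∧
      ∃ i, f i z = -1 ∧ f i x ≠ -1 := by
  have hd : x - b ≠ 0 := sub_ne_zero.2 hxb
  have hcl : Topology.IsClosedEmbedding (fun t : ℝ => x + t • (x - b)) :=
    (Homeomorph.addLeft x).isClosedEmbedding.comp (isClosedEmbedding_smul_left hd)
  have hcomp : IsCompact (((fun t : ℝ => x + t • (x - b)) ⁻¹' polyhedron f) ∩ Set.Ici 0) :=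
    (hcl.isCompact_preimage hK).inter_right isClosed_Ici
  obtain ⟨t, ⟨ht, ht0⟩, hmax⟩ := hcomp.exists_isMaxOn (f := id) ⟨0, by simpa using hx, by simp⟩
    continuous_id.continuousOn
  have ht0 : (0 : ℝ) ≤ t := ht0
  have hz : x + t • (x - b) ∈ polyhedron f := ht
  have hzact : ∀ i, f i x = -1 → f i (x + t • (x - b)) = -1 := fun i hi => by
    simp [hi, hact i hi]
  refine ⟨_, hz, ?_, hzact, ?_⟩
  · refine ⟨t / (1 + t), 1 / (1 + t), by positivity, by positivity, by field_simp; ring, ?_⟩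
    have h : (1 + t) ≠ 0 := by positivity
    have : ((1 + t) : ℝ)⁻¹ • ((1 + t) • x) = x := inv_smul_smul₀ h x
    conv_rhs => rw [← this]
    simp only [div_eq_inv_mul, mul_smul, ← smul_add]
    congr 1
    module
  -- If no new constraint were active at the last point of the ray, the ray could be prolonged
  -- inside the polyhedron.
  · by_contra! hn
    obtain ⟨ε, hε, hm⟩ := exists_pos_add_smul_mem f (d := x - b) hz fun i hi => by
      have hi' := hn i hi
      simp [hi', hact i hi']
    have : id (t + ε) ≤ id t := hmax ⟨by
      change x + (t + ε) • (x - b) ∈ polyhedron f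
      rwa [add_smul, ← add_assoc], by simp; positivity⟩
    simp only [id] at this
    linarith

/-- Induction on the number of inactive constraints. The ray from the barycenter of the carrier face
through `x` exits at a point `z` with more active constraints, and a flag for `z` is enlarged by the
carrier face of `x`. Containment in the carrier face is part of the claim so that the enlarged
family remains a chain. -/
theorem exists_flag_le_carrierFace (hK : IsCompact (polyhedron f)) (n : ℕ) :
    ∀ x ∈ frontier (polyhedron f), {i | f i x ≠ -1}.ncard ≤ n →
    ∃ c, IsFlag (polyhedron f) c ∧ (∀ A ∈ c, A ⊆ carrierFace f x) ∧
      x ∈ convexHull ℝ (barycenter '' (c : Set (Set E))) := by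
  classical
  induction n with
  | zero =>
    intro x hx hn
    have hall : ∀ i, f i x = -1 := by
      by_contra! h
      have := (Set.ncard_eq_zero (Set.toFinite _)).1 (Nat.le_zero.1 hn)
      obtain ⟨i, hi⟩ := h
      have h' : i ∈ {i | f i x ≠ -1} := hi
      rw [this] at h'
      exact h'
    have hF := isProperFace_carrierFace hx
    by_cases hxb : x = barycenter (carrierFace f x)
    · refine ⟨{carrierFace f x}, ⟨by simp, by simpa using hF, by simp⟩, by simp, ?_⟩
      simpa using hxb
    · obtain ⟨z, -, -, -, i, -, hi⟩ := exists_ray_exit hK (mem_frontier_polyhedron.1 hx).1 hxb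
        fun i => (active_barycenter_carrierFace hK hx i).2
      exact (hi (hall i)).elim
  | succ n ih =>
    intro x hx hn
    have hF := isProperFace_carrierFace hx
    by_cases hxb : x = barycenter (carrierFace f x)
    · refine ⟨{carrierFace f x}, ⟨by simp, by simpa using hF, by simp⟩, by simp, ?_⟩
      simpa using hxb
    obtain ⟨z, hz, hseg, hzact, i, hiz, hix⟩ := exists_ray_exit hK
      (mem_frontier_polyhedron.1 hx).1 hxb fun i => (active_barycenter_carrierFace hK hx i).2
    have hlt : {i | f i z ≠ -1}.ncard < {i | f i x ≠ -1}.ncard := by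
      refine Set.ncard_lt_ncard ⟨fun j hj hj' => hj (hzact j hj'), fun h => ?_⟩ (Set.toFinite _)
      exact h (show i ∈ {i | f i x ≠ -1} from hix) hiz
    obtain ⟨c, hc, hcF, hzc⟩ := ih z (mem_frontier_polyhedron.2 ⟨hz, i, hiz⟩) (by omega)
    have hsub : carrierFace f z ⊆ carrierFace f x := fun y hy =>
      ⟨hy.1, fun j hj => hy.2 j (hzact j hj)⟩
    refine ⟨insert (carrierFace f x) c, ⟨by simp, ?_, ?_⟩, ?_, ?_⟩
    · simpa [hF] using hc.2.1
    · rw [Finset.coe_insert]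
      exact hc.2.2.insert fun A hA _ => Or.inr ((hcF A hA).trans hsub)
    · simpa using fun A hA => (hcF A hA).trans hsub
    · refine (convex_convexHull ℝ _).segment_subset (subset_convexHull ℝ _ ?_) ?_ hseg
      · exact ⟨_, by simp, rfl⟩
      · exact convexHull_mono (Set.image_mono (by simp)) hzc

/-- The barycentric simplices of the flags of proper faces cover the boundary of a polytope. -/
theorem exists_flag_mem_convexHull (hK : IsCompact (polyhedron f)) {x : E}
    (hx : x ∈ frontier (polyhedron f)) :
    ∃ c, IsFlag (polyhedron f) c ∧ x ∈ convexHull ℝ (barycenter '' (c : Set (Set E))) := by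
  obtain ⟨c, hc, -, h⟩ := exists_flag_le_carrierFace hK _ x hx le_rfl
  exact ⟨c, hc, h⟩

end Compact

end Polytope


/-! ### Uniqueness of barycentric coordinates on flag simplices. -/

theorem mem_convexHull_image_iff {α E : Type*} [AddCommGroup E] [Module ℝ E] (φ : α → E)
    (c : Finset α) (x : E) :
    x ∈ convexHull ℝ (φ '' (c : Set α)) ↔
      ∃ t : α → ℝ, (∀ a ∈ c, 0 ≤ t a) ∧ ∑ a ∈ c, t a = 1 ∧ ∑ a ∈ c, t a • φ a = x := by
  classical
  constructor
  · intro hx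
    have hsub : convexHull ℝ (φ '' (c : Set α)) ⊆ {x | ∃ t : α → ℝ, (∀ a ∈ c, 0 ≤ t a) ∧
        ∑ a ∈ c, t a = 1 ∧ ∑ a ∈ c, t a • φ a = x} := by
      refine convexHull_min ?_ ?_
      · rintro _ ⟨a, ha, rfl⟩
        refine ⟨Pi.single a 1, fun b _ => ?_, ?_, ?_⟩
        · by_cases h : b = a <;> simp [h]
        · simp [Pi.single_apply, Finset.mem_coe.1 ha]
        · simp [Pi.single_apply, ite_smul, Finset.mem_coe.1 ha]
      · rintro _ ⟨t, h1, h2, rfl⟩ _ ⟨u, h3, h4, rfl⟩ p q hp hq hpq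
        refine ⟨fun a => p * t a + q * u a, fun a ha => ?_, ?_, ?_⟩
        · have := h1 a ha
          have := h3 a ha
          positivity
        · rw [Finset.sum_add_distrib, ← Finset.mul_sum, ← Finset.mul_sum, h2, h4]
          simpa using hpq
        · simp only [add_smul, mul_smul, Finset.sum_add_distrib, Finset.smul_sum]
    exact hsub hx
  · rintro ⟨t, h1, h2, rfl⟩
    exact (convex_convexHull ℝ _).sum_mem h1 h2
      fun a ha => subset_convexHull ℝ _ ⟨a, ha, rfl⟩

section Polytope

variable {E : Type*} [AddCommGroup E] [Module ℝ E] [TopologicalSpace E] {ι : Type*}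
variable [IsTopologicalAddGroup E] [ContinuousSMul ℝ E] [T2Space E] [LocallyConvexSpace ℝ E]
variable [Finite ι] {f : ι → StrongDual ℝ E}

/-- A nonempty finite chain of sets has a largest element. -/
theorem exists_top_of_isChain {α : Type*} {c : Finset (Set α)} (hne : c.Nonempty)
    (hc : IsChain (· ⊆ ·) (c : Set (Set α))) : ∃ A ∈ c, ∀ B ∈ c, B ⊆ A := by
  obtain ⟨A, hA⟩ := c.exists_maximal hne
  refine ⟨A, hA.1, fun B hB => ?_⟩
  rcases hc.total hA.1 hB with h | h
  · exact hA.2 hB h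
  · exact h

/-- Nonnegative combinations of the barycenters of a chain of proper faces contained in `A`. -/
theorem map_sum_barycenter_eq (hK : IsCompact (polyhedron f)) {C : Finset (Set E)} {t : Set E → ℝ}
    (hC : ∀ A ∈ C, IsProperFace (polyhedron f) A) {A : Set E}
    (hA : IsProperFace (polyhedron f) A) (hle : ∀ B ∈ C, t B ≠ 0 → B ⊆ A) {i : ι}
    (hi : f i (barycenter A) = -1) : f i (∑ B ∈ C, t B • barycenter B) = -∑ B ∈ C, t B := by
  rw [map_sum, ← Finset.sum_neg_distrib]
  refine Finset.sum_congr rfl fun B hB => ?_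
  by_cases h : t B = 0
  · simp [h]
  · simp [((hC B hB).subset_iff hK hA).1 (hle B hB h) i hi]

theorem neg_sum_le_map_sum_barycenter (hK : IsCompact (polyhedron f)) {C : Finset (Set E)}
    {t : Set E → ℝ} (hC : ∀ A ∈ C, IsProperFace (polyhedron f) A) (ht : ∀ A ∈ C, 0 ≤ t A) (i : ι) :
    -∑ B ∈ C, t B ≤ f i (∑ B ∈ C, t B • barycenter B) := by
  rw [map_sum, ← Finset.sum_neg_distrib]
  refine Finset.sum_le_sum fun B hB => ?_
  have h1 := (hC B hB).subset ((hC B hB).barycenter_mem hK) i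
  have h2 := mul_le_mul_of_nonneg_left h1 (ht B hB)
  simpa using h2

theorem exists_top_of_isChain_support {C : Finset (Set E)} {t : Set E → ℝ}
    (hch : IsChain (· ⊆ ·) {A | A ∈ C ∧ t A ≠ 0}) {A : Set E} (hA : A ∈ C) (htA : t A ≠ 0) :
    ∃ A ∈ C, t A ≠ 0 ∧ ∀ B ∈ C, t B ≠ 0 → B ⊆ A := by
  classical
  obtain ⟨T, hT, hmax⟩ := exists_top_of_isChain (c := C.filter fun A => t A ≠ 0)
    ⟨A, by simp [hA, htA]⟩ (by simpa using hch)
  refine ⟨T, (Finset.mem_filter.1 hT).1, (Finset.mem_filter.1 hT).2, fun B hB hB' =>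
    hmax B (by simp [hB, hB'])⟩

/-- A constraint active at the largest face occurring in `t` turns the first combination into minus
its mass, while the second stays at least minus the mass of `t'`. -/
theorem mass_le (hK : IsCompact (polyhedron f)) {C : Finset (Set E)}
    (hC : ∀ A ∈ C, IsProperFace (polyhedron f) A) {t t' : Set E → ℝ}
    (ht' : ∀ A ∈ C, 0 ≤ t' A) (hch : IsChain (· ⊆ ·) {A | A ∈ C ∧ t A ≠ 0})
    (h : ∑ A ∈ C, t A • barycenter A = ∑ A ∈ C, t' A • barycenter A) :
    ∑ A ∈ C, t A ≤ ∑ A ∈ C, t' A := by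
  by_cases h0 : ∀ A ∈ C, t A = 0
  · rw [Finset.sum_eq_zero h0]
    exact Finset.sum_nonneg ht'
  push Not at h0
  obtain ⟨A, hA, htA⟩ := h0
  obtain ⟨T, hT, -, hmax⟩ := exists_top_of_isChain_support hch hA htA
  obtain ⟨i, hi⟩ := (hC T hT).exists_active hK
  have h1 := map_sum_barycenter_eq hK hC (hC T hT) hmax hi
  have h2 := neg_sum_le_map_sum_barycenter hK hC ht' i
  rw [← h, h1] at h2
  linarith

/-- The masses agree by `mass_le` in both directions. A constraint active at the largest face of
`t'` must then equal `-1` at every barycenter occurring in `t`, so this face contains all faces of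
`t`. -/
theorem exists_superset_of_sum_eq (hK : IsCompact (polyhedron f)) {C : Finset (Set E)}
    (hC : ∀ A ∈ C, IsProperFace (polyhedron f) A) {t t' : Set E → ℝ}
    (ht : ∀ A ∈ C, 0 ≤ t A) (hch : IsChain (· ⊆ ·) {A | A ∈ C ∧ t A ≠ 0})
    (ht' : ∀ A ∈ C, 0 ≤ t' A) (hch' : IsChain (· ⊆ ·) {A | A ∈ C ∧ t' A ≠ 0})
    (h : ∑ A ∈ C, t A • barycenter A = ∑ A ∈ C, t' A • barycenter A)
    {A : Set E} (hA : A ∈ C) (htA : t A ≠ 0) : ∃ B ∈ C, t' B ≠ 0 ∧ A ⊆ B := by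
  have hm := (mass_le hK hC ht' hch h).antisymm (mass_le hK hC ht hch' h.symm)
  have hpos : 0 < ∑ A ∈ C, t' A := by
    rw [← hm]
    exact Finset.sum_pos' ht ⟨A, hA, (ht A hA).lt_of_ne' htA⟩
  obtain ⟨B, hB, htB⟩ : ∃ B ∈ C, t' B ≠ 0 := by
    by_contra! h0
    rw [Finset.sum_eq_zero h0] at hpos
    exact lt_irrefl _ hpos
  obtain ⟨T, hT, htT, hmax⟩ := exists_top_of_isChain_support hch' hB htB
  refine ⟨T, hT, htT, ((hC A hA).subset_iff hK (hC T hT)).2 fun i hi => ?_⟩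
  have h1 := map_sum_barycenter_eq hK hC (hC T hT) hmax hi
  rw [← h, ← hm, map_sum] at h1
  have h2 : ∑ A ∈ C, t A * (f i (barycenter A) + 1) = 0 := by
    simp only [map_smul, smul_eq_mul] at h1
    simp only [mul_add, mul_one, Finset.sum_add_distrib, h1]
    ring
  have h3 := (Finset.sum_eq_zero_iff_of_nonneg fun B hB => mul_nonneg (ht B hB) (by
    have := (hC B hB).subset ((hC B hB).barycenter_mem hK) i
    linarith)).1 h2 A hA
  have := (mul_eq_zero.1 h3).resolve_left htA
  linarith

/-- Uniqueness of barycentric coordinates in the barycentric subdivision of the boundary. -/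
theorem eq_of_sum_barycenter_eq (hK : IsCompact (polyhedron f)) {C : Finset (Set E)}
    (hC : ∀ A ∈ C, IsProperFace (polyhedron f) A) {t t' : Set E → ℝ}
    (ht : ∀ A ∈ C, 0 ≤ t A) (hch : IsChain (· ⊆ ·) {A | A ∈ C ∧ t A ≠ 0})
    (ht' : ∀ A ∈ C, 0 ≤ t' A) (hch' : IsChain (· ⊆ ·) {A | A ∈ C ∧ t' A ≠ 0})
    (h : ∑ A ∈ C, t A • barycenter A = ∑ A ∈ C, t' A • barycenter A) :
    ∀ A ∈ C, t A = t' A := by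
  classical
  by_contra! hne
  obtain ⟨A₀, hA₀, hne⟩ := hne
  obtain ⟨A, hA⟩ := (C.filter fun A => t A ≠ t' A).exists_maximal ⟨A₀, by simp [hA₀, hne]⟩
  have hAC := (Finset.mem_filter.1 hA.1).1
  have hAne := (Finset.mem_filter.1 hA.1).2
  -- Removing the common part leaves equal combinations with disjoint supports that are still
  -- chains. The maximal face `A` where the weights differ is in one support, and
  -- `exists_superset_of_sum_eq` then puts it in the other as well.
  set m : Set E → ℝ := fun A => min (t A) (t' A) with hm
  have h0 : ∀ A ∈ C, 0 ≤ (t - m) A := fun A _ => by simp [hm]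
  have h0' : ∀ A ∈ C, 0 ≤ (t' - m) A := fun A _ => by simp [hm]
  have hz : ∀ A ∈ C, (t - m) A ≠ 0 → t A ≠ 0 := fun A hA h1 h2 => h1 (by
    have := ht' A hA; simp [hm, h2, this])
  have hz' : ∀ A ∈ C, (t' - m) A ≠ 0 → t' A ≠ 0 := fun A hA h1 h2 => h1 (by
    have := ht A hA; simp [hm, h2, this])
  have hc : IsChain (· ⊆ ·) {A | A ∈ C ∧ (t - m) A ≠ 0} :=
    by
    refine hch.mono ?_
    rintro A ⟨hA, hA'⟩
    exact ⟨hA, hz A hA hA'⟩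
  have hc' : IsChain (· ⊆ ·) {A | A ∈ C ∧ (t' - m) A ≠ 0} :=
    by
    refine hch'.mono ?_
    rintro A ⟨hA, hA'⟩
    exact ⟨hA, hz' A hA hA'⟩
  have hs : ∑ A ∈ C, (t - m) A • barycenter A = ∑ A ∈ C, (t' - m) A • barycenter A := by
    simp only [Pi.sub_apply, sub_smul, Finset.sum_sub_distrib, h]
  have hmem : ∀ B ∈ C, ((t - m) B ≠ 0 ∨ (t' - m) B ≠ 0) → t B ≠ t' B := by
    intro B _ hB heq
    simp [hm, heq] at hB
  have hfin : ∀ B ∈ C, t B ≠ t' B → A ⊆ B → B = A := fun B hB hBne hAB =>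
    (hA.2 (by simp [hB, hBne]) hAB).antisymm hAB
  rcases lt_or_gt_of_ne hAne with hlt | hlt
  · have h1 : (t' - m) A ≠ 0 := by simp [hm, hlt.le, sub_ne_zero, hlt.ne']
    obtain ⟨B, hB, hB', hAB⟩ := exists_superset_of_sum_eq hK hC h0' hc' h0 hc hs.symm hAC h1
    rw [hfin B hB (hmem B hB (Or.inl hB')) hAB] at hB'
    simp [hm, hlt.le] at hB'
  · have h1 : (t - m) A ≠ 0 := by simp [hm, hlt.le, sub_ne_zero, hlt.ne']
    obtain ⟨B, hB, hB', hAB⟩ := exists_superset_of_sum_eq hK hC h0 hc h0' hc' hs hAC h1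
    rw [hfin B hB (hmem B hB (Or.inr hB')) hAB] at hB'
    simp [hm, hlt.le] at hB'

/-- The barycenters of the faces of a flag are linearly independent. -/
theorem linearIndepOn_barycenter (hK : IsCompact (polyhedron f)) {c : Finset (Set E)}
    (hc : IsFlag (polyhedron f) c) : LinearIndepOn ℝ barycenter (c : Set (Set E)) := by
  rw [linearIndepOn_finset_iff]
  intro g hg
  have hch : ∀ t : Set E → ℝ, IsChain (· ⊆ ·) {A | A ∈ c ∧ t A ≠ 0} :=
    fun t => hc.2.2.mono fun A hA => hA.1
  -- The positive and negative parts of `g` are two nonnegative weights on the same chain with the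
  -- same sum.
  have := eq_of_sum_barycenter_eq hK hc.2.1 (t := fun A => max (g A) 0)
    (t' := fun A => max (-g A) 0) (fun _ _ => le_max_right _ _) (hch _)
    (fun _ _ => le_max_right _ _) (hch _) (by
      rw [← sub_eq_zero, ← Finset.sum_sub_distrib, ← hg]
      refine Finset.sum_congr rfl fun A _ => ?_
      rw [← sub_smul, max_zero_sub_eq_self])
  intro A hA
  have h := this A hA
  have h2 := max_zero_sub_eq_self (g A)
  linarith

/-- Linear independence, stronger than affine independence, lets a linear map be prescribed on the
barycenters of a flag. It provides the affine pieces of the homeomorphism. -/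
theorem exists_linearMap_barycenter {F : Type*} [AddCommGroup F] [Module ℝ F]
    (hK : IsCompact (polyhedron f)) {c : Finset (Set E)} (hc : IsFlag (polyhedron f) c)
    (v : Set E → F) : ∃ g : E →ₗ[ℝ] F, ∀ A ∈ c, g (barycenter A) = v A := by
  have hli : LinearIndependent ℝ (fun A : (c : Set (Set E)) => barycenter A.1) :=
    linearIndepOn_barycenter hK hc
  obtain ⟨g, hg⟩ := LinearMap.exists_extend ((Module.Basis.span hli).constr ℝ
    fun A : (c : Set (Set E)) => v A.1)
  refine ⟨g, fun A hA => ?_⟩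
  have h := LinearMap.congr_fun hg (Module.Basis.span hli ⟨A, hA⟩)
  rw [Module.Basis.constr_basis] at h
  rw [← h, LinearMap.comp_apply]
  congr 1
  exact congrArg Subtype.val (Module.Basis.span_apply hli ⟨A, hA⟩).symm

theorem sum_smul_eq_sum_union_left {α F : Type*} [DecidableEq α] [AddCommGroup F] [Module ℝ F]
    (c c' : Finset α) (t : α → ℝ) (v : α → F) :
    ∑ A ∈ c, t A • v A = ∑ A ∈ c ∪ c', (if A ∈ c then t A else 0) • v A := by
  simp [ite_smul, Finset.sum_ite_mem]

theorem sum_smul_eq_sum_union_right {α F : Type*} [DecidableEq α] [AddCommGroup F] [Module ℝ F]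
    (c c' : Finset α) (t : α → ℝ) (v : α → F) :
    ∑ A ∈ c', t A • v A = ∑ A ∈ c ∪ c', (if A ∈ c' then t A else 0) • v A := by
  simp [ite_smul, Finset.sum_ite_mem]

/-- This makes the correspondence well defined: a point in two flag simplices has the same
coordinates in both, after extension by zero to the union of the flags. -/
theorem sum_eq_of_sum_barycenter_eq {F : Type*} [AddCommGroup F] [Module ℝ F]
    (hK : IsCompact (polyhedron f)) {c c' : Finset (Set E)}
    (hc : IsFlag (polyhedron f) c) (hc' : IsFlag (polyhedron f) c') {t t' : Set E → ℝ}
    (ht : ∀ A ∈ c, 0 ≤ t A) (ht' : ∀ A ∈ c', 0 ≤ t' A)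
    (h : ∑ A ∈ c, t A • barycenter A = ∑ A ∈ c', t' A • barycenter A) (v : Set E → F) :
    ∑ A ∈ c, t A • v A = ∑ A ∈ c', t' A • v A := by
  classical
  have key := eq_of_sum_barycenter_eq hK (C := c ∪ c') (t := fun A => if A ∈ c then t A else 0)
    (t' := fun A => if A ∈ c' then t' A else 0)
    (fun A hA => (Finset.mem_union.1 hA).elim (hc.2.1 A) (hc'.2.1 A))
    (fun A _ => by split_ifs with h; exacts [ht A h, le_rfl])
    (hc.2.2.mono fun A hA => by by_contra h; simp_all)
    (fun A _ => by split_ifs with h; exacts [ht' A h, le_rfl])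
    (hc'.2.2.mono fun A hA => by by_contra h; simp_all)
    (by rwa [← sum_smul_eq_sum_union_left, ← sum_smul_eq_sum_union_right])
  rw [sum_smul_eq_sum_union_left c c', sum_smul_eq_sum_union_right c c']
  exact Finset.sum_congr rfl fun A hA => by rw [key A hA]

end Polytope


/-! ### From a duality of face lattices to a piecewise linear homeomorphism of boundaries. -/

section Duality

variable {E : Type*} [AddCommGroup E] [Module ℝ E] [TopologicalSpace E]
  [IsTopologicalAddGroup E] [ContinuousSMul ℝ E] [T2Space E] [LocallyConvexSpace ℝ E]
  {F : Type*} [AddCommGroup F] [Module ℝ F] [TopologicalSpace F]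
  [IsTopologicalAddGroup F] [ContinuousSMul ℝ F] [T2Space F] [LocallyConvexSpace ℝ F]
  {ι κ : Type*} [Finite ι] [Finite κ] {f : ι → StrongDual ℝ E} {g : κ → StrongDual ℝ F}

/-- `d` is an inclusion-reversing map from the proper faces of `P` to those of `Q`, with left
inverse `d'`. -/
structure IsFaceDuality (P : Set E) (Q : Set F) (d : Set E → Set F) (d' : Set F → Set E) :
    Prop where
  isProperFace : ∀ A, IsProperFace P A → IsProperFace Q (d A)
  left_inv : ∀ A, IsProperFace P A → d' (d A) = A
  antitone : ∀ A B, IsProperFace P A → IsProperFace P B → A ⊆ B → d B ⊆ d A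

variable {P : Set E} {Q : Set F} {d : Set E → Set F} {d' : Set F → Set E}

open Classical in
theorem IsFlag.image (h : IsFaceDuality P Q d d') {c : Finset (Set E)} (hc : IsFlag P c) :
    IsFlag Q (c.image d) := by
  refine ⟨hc.1.image d, fun B hB => ?_, ?_⟩
  · obtain ⟨A, hA, rfl⟩ := Finset.mem_image.1 hB
    exact h.isProperFace A (hc.2.1 A hA)
  · rintro B hB C hC -
    obtain ⟨A, hA, rfl⟩ := Finset.mem_image.1 (Finset.mem_coe.1 hB)
    obtain ⟨A', hA', rfl⟩ := Finset.mem_image.1 (Finset.mem_coe.1 hC)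
    rcases hc.2.2.total hA hA' with h1 | h1
    · exact Or.inr (h.antitone A A' (hc.2.1 A hA) (hc.2.1 A' hA') h1)
    · exact Or.inl (h.antitone A' A (hc.2.1 A' hA') (hc.2.1 A hA) h1)

open Classical in
theorem IsFlag.sum_image (h : IsFaceDuality P Q d d') {c : Finset (Set E)} (hc : IsFlag P c)
    {G : Type*} [AddCommMonoid G] (φ : Set F → G) :
    ∑ B ∈ c.image d, φ B = ∑ A ∈ c, φ (d A) := by
  refine Finset.sum_image fun A hA B hB hAB => ?_
  rw [← h.left_inv A (hc.2.1 A hA), hAB, h.left_inv B (hc.2.1 B hB)]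

/-- The graph of the dual-face barycentric correspondence. -/
def dualGraph (P : Set E) (d : Set E → Set F) : Set (E × F) :=
  ⋃ c ∈ {c | IsFlag P c},
    convexHull ℝ ((fun A => (barycenter A, barycenter (d A))) '' (c : Set (Set E)))

theorem mem_dualGraph {p : E × F} : p ∈ dualGraph P d ↔
    ∃ c, IsFlag P c ∧ ∃ t : Set E → ℝ, (∀ A ∈ c, 0 ≤ t A) ∧ ∑ A ∈ c, t A = 1 ∧
      ∑ A ∈ c, t A • barycenter A = p.1 ∧ ∑ A ∈ c, t A • barycenter (d A) = p.2 := by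
  simp only [dualGraph, Set.mem_iUnion, exists_prop, Set.mem_ofPred_eq, mem_convexHull_image_iff,
    Prod.ext_iff, Prod.fst_sum, Prod.snd_sum, Prod.smul_mk]

theorem isCompact_dualGraph (hP : IsCompact (polyhedron f)) :
    IsCompact (dualGraph (polyhedron f) d) :=
  (finite_flags hP).isCompact_biUnion fun c _ =>
    (c.finite_toSet.image _).isCompact_convexHull ℝ

theorem IsFlag.sum_mem_frontier (hP : IsCompact (polyhedron f)) {c : Finset (Set E)}
    (hc : IsFlag (polyhedron f) c) {t : Set E → ℝ} (ht : ∀ A ∈ c, 0 ≤ t A)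
    (h1 : ∑ A ∈ c, t A = 1) : ∑ A ∈ c, t A • barycenter A ∈ frontier (polyhedron f) := by
  obtain ⟨A, hA, hmax⟩ := exists_top_of_isChain hc.1 hc.2.2
  obtain ⟨i, hi⟩ := (hc.2.1 A hA).exists_active hP
  refine mem_frontier_polyhedron.2 ⟨(convex_polyhedron f).sum_mem ht h1 fun B hB =>
    (hc.2.1 B hB).subset ((hc.2.1 B hB).barycenter_mem hP), i, ?_⟩
  rw [map_sum_barycenter_eq hP hc.2.1 (hc.2.1 A hA) (fun B hB _ => hmax B hB) hi, h1]

/-- The dual faces of a flag form a flag of the other polytope, with the same weights, so the graph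
is the same seen from either side. -/
theorem dualGraph_swap (h : IsFaceDuality P Q d d') (h' : IsFaceDuality Q P d' d) {p : E × F} :
    p.swap ∈ dualGraph Q d' ↔ p ∈ dualGraph P d := by
  classical
  rw [mem_dualGraph, mem_dualGraph]
  constructor
  · rintro ⟨c, hc, t, h1, h2, h3, h4⟩
    refine ⟨c.image d', hc.image h', fun A => t (d A), ?_, ?_, ?_, ?_⟩
    · intro A hA
      obtain ⟨B, hB, rfl⟩ := Finset.mem_image.1 hA
      simpa [h'.left_inv B (hc.2.1 B hB)] using h1 B hB
    · rw [hc.sum_image h' (fun A => t (d A)), ← h2]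
      exact Finset.sum_congr rfl fun B hB => by rw [h'.left_inv B (hc.2.1 B hB)]
    · rw [hc.sum_image h' (fun A => t (d A) • barycenter A), ← Prod.snd_swap, ← h4]
      exact Finset.sum_congr rfl fun B hB => by rw [h'.left_inv B (hc.2.1 B hB)]
    · rw [hc.sum_image h' (fun A => t (d A) • barycenter (d A)), ← Prod.fst_swap, ← h3]
      exact Finset.sum_congr rfl fun B hB => by rw [h'.left_inv B (hc.2.1 B hB)]
  · rintro ⟨c, hc, t, h1, h2, h3, h4⟩
    refine ⟨c.image d, hc.image h, fun A => t (d' A), ?_, ?_, ?_, ?_⟩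
    · intro A hA
      obtain ⟨B, hB, rfl⟩ := Finset.mem_image.1 hA
      simpa [h.left_inv B (hc.2.1 B hB)] using h1 B hB
    · rw [hc.sum_image h (fun A => t (d' A)), ← h2]
      exact Finset.sum_congr rfl fun B hB => by rw [h.left_inv B (hc.2.1 B hB)]
    · rw [hc.sum_image h (fun A => t (d' A) • barycenter A), Prod.fst_swap, ← h4]
      exact Finset.sum_congr rfl fun B hB => by rw [h.left_inv B (hc.2.1 B hB)]
    · rw [hc.sum_image h (fun A => t (d' A) • barycenter (d' A)), Prod.snd_swap, ← h3]
      exact Finset.sum_congr rfl fun B hB => by rw [h.left_inv B (hc.2.1 B hB)]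

/-- Injectivity is uniqueness of coordinates; surjectivity is the covering of the boundary by flag
simplices. -/
theorem bijective_fst_dualGraph (hP : IsCompact (polyhedron f)) :
    ∃ hmem : ∀ p : dualGraph (polyhedron f) d, p.1.1 ∈ frontier (polyhedron f),
      Function.Bijective fun p : dualGraph (polyhedron f) d =>
        (⟨p.1.1, hmem p⟩ : frontier (polyhedron f)) := by
  refine ⟨fun p => ?_, ?_, ?_⟩
  · obtain ⟨c, hc, t, h1, h2, h3, -⟩ := mem_dualGraph.1 p.2
    rw [← h3]
    exact hc.sum_mem_frontier hP h1 h2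
  · rintro ⟨p, hp⟩ ⟨q, hq⟩ hpq
    have hpq : p.1 = q.1 := congrArg Subtype.val hpq
    refine Subtype.ext (Prod.ext hpq ?_)
    obtain ⟨c, hc, t, h1, h2, h3, h4⟩ := mem_dualGraph.1 hp
    obtain ⟨c', hc', t', h1', h2', h3', h4'⟩ := mem_dualGraph.1 hq
    rw [← h4, ← h4']
    exact sum_eq_of_sum_barycenter_eq hP hc hc' h1 h1' (by rw [h3, h3', hpq])
      fun A => barycenter (d A)
  · rintro ⟨x, hx⟩
    obtain ⟨c, hc, hxc⟩ := exists_flag_mem_convexHull hP hx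
    obtain ⟨t, h1, h2, h3⟩ := (mem_convexHull_image_iff _ _ _).1 hxc
    exact ⟨⟨(x, ∑ A ∈ c, t A • barycenter (d A)), mem_dualGraph.2 ⟨c, hc, t, h1, h2, h3, rfl⟩⟩,
      rfl⟩

/-- The projection of the graph of the correspondence to its source is a homeomorphism. -/
theorem exists_homeomorph_dualGraph (hP : IsCompact (polyhedron f)) (d : Set E → Set F) :
    ∃ e : dualGraph (polyhedron f) d ≃ₜ frontier (polyhedron f), ∀ p, (e p : E) = p.1.1 := by
  obtain ⟨hmem, hb⟩ := bijective_fst_dualGraph (d := d) hP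
  have : CompactSpace (dualGraph (polyhedron f) d) :=
    isCompact_iff_compactSpace.1 (isCompact_dualGraph hP)
  have hcont : Continuous (Equiv.ofBijective _ hb) :=
    (continuous_fst.comp continuous_subtype_val).subtype_mk _
  exact ⟨hcont.homeoOfEquivCompactToT2, fun p => rfl⟩

/-- A duality of the face lattices of two polytopes induces a piecewise linear homeomorphism of
their boundaries that is linear on barycentric simplices. -/
theorem exists_homeomorph_of_isFaceDuality (hP : IsCompact (polyhedron f))
    (hQ : IsCompact (polyhedron g)) (h : IsFaceDuality (polyhedron f) (polyhedron g) d d')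
    (h' : IsFaceDuality (polyhedron g) (polyhedron f) d' d) :
    ∃ s : frontier (polyhedron f) ≃ₜ frontier (polyhedron g), IsPiecewiseLinear s ∧
      ∀ c, IsFlag (polyhedron f) c → ∀ t : Set E → ℝ, (∀ A ∈ c, 0 ≤ t A) → ∑ A ∈ c, t A = 1 →
        ∃ hx : ∑ A ∈ c, t A • barycenter A ∈ frontier (polyhedron f),
          (s ⟨_, hx⟩ : F) = ∑ A ∈ c, t A • barycenter (d A) := by
  obtain ⟨e₁, he₁⟩ := exists_homeomorph_dualGraph hP d
  obtain ⟨e₂, he₂⟩ := exists_homeomorph_dualGraph hQ d'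
  let sw : dualGraph (polyhedron f) d ≃ₜ dualGraph (polyhedron g) d' :=
    (Homeomorph.prodComm E F).subtype fun p => (dualGraph_swap h h').symm
  -- A boundary point is lifted to the graph, the factors are swapped, and the result is projected
  -- to the other boundary. Continuity both ways comes from compactness of the graph.
  let s := e₁.symm.trans (sw.trans e₂)
  have hs : ∀ p : dualGraph (polyhedron f) d, (s (e₁ p) : F) = p.1.2 := fun p => by
    simp only [s, Homeomorph.trans_apply, Homeomorph.symm_apply_apply, he₂]
    rfl
  have hflag : ∀ c, IsFlag (polyhedron f) c → ∀ t : Set E → ℝ, (∀ A ∈ c, 0 ≤ t A) →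
      ∑ A ∈ c, t A = 1 → ∃ hx : ∑ A ∈ c, t A • barycenter A ∈ frontier (polyhedron f),
        (s ⟨_, hx⟩ : F) = ∑ A ∈ c, t A • barycenter (d A) := by
    intro c hc t h1 h2
    refine ⟨hc.sum_mem_frontier hP h1 h2, ?_⟩
    have := hs ⟨(∑ A ∈ c, t A • barycenter A, ∑ A ∈ c, t A • barycenter (d A)),
      mem_dualGraph.2 ⟨c, hc, t, h1, h2, rfl, rfl⟩⟩
    refine Eq.trans ?_ this
    congr 2
    exact (Subtype.ext (he₁ ⟨(_, _), _⟩)).symm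
  refine ⟨s, ⟨(fun c : Finset (Set E) => convexHull ℝ (barycenter '' (c : Set (Set E)))) ''
    {c | IsFlag (polyhedron f) c}, (finite_flags hP).image _, ?_, ?_, ?_⟩, hflag⟩
  · classical
    rintro _ ⟨c, -, rfl⟩
    exact ⟨c.image barycenter, by rw [Finset.coe_image]⟩
  · ext x
    simp only [Set.sUnion_image, Set.mem_iUnion, exists_prop, Set.mem_ofPred_eq]
    constructor
    · rintro ⟨c, hc, hx⟩
      obtain ⟨t, h1, h2, rfl⟩ := (mem_convexHull_image_iff _ _ _).1 hx
      exact hc.sum_mem_frontier hP h1 h2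
    · exact exists_flag_mem_convexHull hP
  · rintro _ ⟨c, hc, rfl⟩
    obtain ⟨φ, hφ⟩ := exists_linearMap_barycenter hP hc fun A => barycenter (d A)
    refine ⟨φ.toAffineMap, fun x hx => ?_⟩
    obtain ⟨t, h1, h2, h3⟩ := (mem_convexHull_image_iff _ _ _).1 hx
    obtain ⟨hx', h4⟩ := hflag c hc t h1 h2
    have : x = ⟨_, hx'⟩ := Subtype.ext h3.symm
    rw [this, h4, LinearMap.coe_toAffineMap, map_sum]
    exact Finset.sum_congr rfl fun A hA => by rw [map_smul, hφ A hA]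

end Duality


/-! ### Proper faces as zero loci of normalized supporting functionals. -/

section Functional

variable {E : Type*} [AddCommGroup E] [Module ℝ E] [TopologicalSpace E]
  [IsTopologicalAddGroup E] [ContinuousSMul ℝ E] [T2Space E] [LocallyConvexSpace ℝ E]
  {ι : Type*} [Finite ι] {f : ι → StrongDual ℝ E}

theorem mem_polyhedron {E : Type*} [AddCommGroup E] [Module ℝ E] [TopologicalSpace E]
    {ι : Type*} {f : ι → StrongDual ℝ E} {x : E} : x ∈ polyhedron f ↔ ∀ i, -1 ≤ f i x := Iff.rfl

/-- A proper face is cut out by a linear function with minimum `-1`. -/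
theorem IsProperFace.exists_functional {A : Set E} (h : IsProperFace (polyhedron f) A) :
    ∃ l : StrongDual ℝ E, (∀ x ∈ polyhedron f, -1 ≤ l x) ∧
      A = {x | x ∈ polyhedron f ∧ l x = -1} := by
  obtain ⟨l, hl⟩ := h.2.2 h.1
  obtain ⟨a, ha⟩ := h.1
  have ha' : a ∈ polyhedron f ∧ ∀ y ∈ polyhedron f, l y ≤ l a := by rw [hl] at ha; exact ha
  have h0 : (0 : E) ∈ polyhedron f := fun i => by simp
  -- If the maximum `l a` were zero, moving from the interior point `0` away from any `x` would give
  -- `0 ≤ l x`. Then `l` would vanish on the polyhedron and the face would not be proper.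
  have hpos : 0 < l a := by
    have h1 : 0 ≤ l a := by simpa using ha'.2 0 h0
    refine h1.lt_of_ne fun h2 => h.2.1 ?_
    rw [hl]
    refine Set.Subset.antisymm (fun x hx => hx.1) fun x hx => ⟨hx, fun y hy => ?_⟩
    obtain ⟨ε, hε, hm⟩ := exists_pos_sub_smul_mem f (z := x) h0 fun i hi => by simp at hi
    have h3 := ha'.2 _ hm
    simp only [zero_sub, zero_add, smul_neg, map_neg, map_smul, smul_eq_mul] at h3
    have h4 := ha'.2 y hy
    nlinarith
  refine ⟨-(l a)⁻¹ • l, fun x hx => ?_, ?_⟩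
  · have := ha'.2 x hx
    simp only [smul_apply, smul_eq_mul, neg_mul, neg_le_neg_iff]
    rw [inv_mul_le_iff₀ hpos]
    linarith
  · rw [hl]
    ext x
    simp only [Set.mem_ofPred_eq, smul_apply, smul_eq_mul, neg_mul, neg_inj]
    refine and_congr_right fun hx => ?_
    rw [inv_mul_eq_iff_eq_mul₀ hpos.ne', mul_one]
    exact ⟨fun hy => le_antisymm (ha'.2 x hx) (hy a ha'.1), fun hy y hy' => hy ▸ ha'.2 y hy'⟩

theorem isProperFace_of_functional {l : StrongDual ℝ E} (hl : ∀ x ∈ polyhedron f, -1 ≤ l x)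
    {a : E} (ha : a ∈ polyhedron f) (hla : l a = -1) :
    IsProperFace (polyhedron f) {x | x ∈ polyhedron f ∧ l x = -1} := by
  refine ⟨⟨a, ha, hla⟩, fun h => ?_, fun _ => ⟨-l, ?_⟩⟩
  · have h0 : (0 : E) ∈ polyhedron f := fun i => by simp
    rw [← h] at h0
    simpa using h0.2
  · ext x
    simp only [Set.mem_ofPred_eq, neg_apply, neg_le_neg_iff]
    exact and_congr_right fun hx => ⟨fun h y hy => h ▸ hl y hy, fun h =>
      le_antisymm (hla ▸ h a ha) (hl x hx)⟩

end Functional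

/-! ### The corners of the Newton polyhedron -/

/-- The monomial `z_k⁵`. -/
def corner (k : Fin 5) : Delta0 :=
  ⟨Pi.single k 5, by
    refine Finset.mem_filter.2 ⟨by simp, ?_⟩
    fin_cases k
    · exact ⟨1, 2, by decide, rfl, rfl⟩
    · exact ⟨0, 2, by decide, rfl, rfl⟩
    · exact ⟨0, 1, by decide, rfl, rfl⟩
    · exact ⟨0, 1, by decide, rfl, rfl⟩
    · exact ⟨0, 1, by decide, rfl, rfl⟩⟩

theorem pt_apply (a : Delta0) (i : Fin 5) : (pt a).1 i = (a.1 i : ℝ) - 1 := rfl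

theorem pt_corner_apply (k i : Fin 5) : (pt (corner k)).1 i = (if i = k then 5 else 0) - 1 := by
  rw [pt_apply]
  by_cases h : i = k <;> simp [corner, h]

theorem nVertex_apply (i : Fin 5) (m : MR) : nVertex i m = m.1 i := rfl

theorem MR_sum_eq_zero (m : MR) : ∑ i, m.1 i = 0 := m.2

/-- The entries `-1` of the corners contribute only multiples of the coordinate sum, which vanishes.
The five corners thus serve as a symmetric substitute for a basis. -/
theorem sum_corner_smul (m : MR) : ∑ k, (m.1 k / 5) • pt (corner k) = m := by
  ext i
  have h := MR_sum_eq_zero m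
  simp only [Submodule.coe_sum, Submodule.coe_smul, Finset.sum_apply, Pi.smul_apply,
    pt_corner_apply, smul_eq_mul, mul_sub, mul_one, Finset.sum_sub_distrib]
  rw [← Finset.sum_div, h]
  simp

theorem sum_pt_corner : ∑ k, pt (corner k) = 0 := by
  ext i
  simp [pt_corner_apply]

theorem NR_apply_eq (n : NR) (m : MR) : n m = ∑ k, m.1 k / 5 * n (pt (corner k)) := by
  conv_lhs => rw [← sum_corner_smul m]
  simp

theorem NR_ext_corner {n n' : NR} (h : ∀ k, n (pt (corner k)) = n' (pt (corner k))) : n = n' := by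
  ext m
  rw [NR_apply_eq, NR_apply_eq n']
  simp [h]

/-- Evaluation at a point of `M`. -/
def evalM (m : MR) : StrongDual ℝ NR := ContinuousLinearMap.apply ℝ ℝ m

theorem evalM_apply (m : MR) (n : NR) : evalM m n = n m := rfl

/-- Each `n` is the combination of the `nVertex k` with coefficients `n (pt (corner k)) / 5`, which
makes the representing point explicit. -/
theorem exists_eq_evalM (l : StrongDual ℝ NR) : ∃ m, l = evalM m := by
  refine ⟨∑ k, (l (nVertex k) / 5) • pt (corner k), ?_⟩
  ext n
  have hn : n = ∑ k, (n (pt (corner k)) / 5) • nVertex k := by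
    ext m
    rw [NR_apply_eq, sum_apply]
    refine Finset.sum_congr rfl fun k _ => ?_
    simp only [smul_apply, smul_eq_mul, nVertex_apply]
    ring
  conv_lhs => rw [hn]
  rw [evalM_apply, map_sum, map_sum]
  refine Finset.sum_congr rfl fun k _ => ?_
  simp only [map_smul, smul_eq_mul]
  ring

/-! ### The polytopes `Δ_w` and its dual -/

variable {w : Delta0 → ℝ}

/-- The vertex of the dual of `Δ_w` on the ray through an integral point. -/
def dualVertex (w : Delta0 → ℝ) (a : Delta0) : MR := (w a)⁻¹ • pt a

theorem apply_dualVertex (n : NR) (a : Delta0) : n (dualVertex w a) = (w a)⁻¹ * n (pt a) := by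
  simp [dualVertex]

theorem ell_eq (hpos : ∀ a, 0 < w a) (a : Delta0) (n : NR) :
    ell w a n = w a * (n (dualVertex w a) + 1) := by
  rw [apply_dualVertex, mul_add, mul_inv_cancel_left₀ (hpos a).ne', mul_one, ell]

theorem ell_eq_zero_iff (hpos : ∀ a, 0 < w a) (a : Delta0) (n : NR) :
    ell w a n = 0 ↔ n (dualVertex w a) = -1 := by
  rw [ell_eq hpos, mul_eq_zero, or_iff_right (hpos a).ne', add_eq_zero_iff_eq_neg]

theorem ell_nonneg_iff (hpos : ∀ a, 0 < w a) (a : Delta0) (n : NR) :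
    0 ≤ ell w a n ↔ -1 ≤ n (dualVertex w a) := by
  rw [ell_eq hpos, mul_nonneg_iff_of_pos_left (hpos a), ← neg_le_iff_add_nonneg]

theorem DeltaW_eq (hpos : ∀ a, 0 < w a) :
    DeltaW w = polyhedron fun a => evalM (dualVertex w a) := by
  ext n
  exact forall_congr' fun a => ell_nonneg_iff hpos a n

/-- The values of `n` at the five corners sum to zero, so their lower bounds also bound each of them
from above. These values determine `n` injectively, so `Δ_w` is a closed subset of the preimage of a
box. -/
theorem isCompact_DeltaW (hpos : ∀ a, 0 < w a) : IsCompact (DeltaW w) := by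
  let T : NR →ₗ[ℝ] (Fin 5 → ℝ) := LinearMap.pi fun k => (evalM (pt (corner k)) : NR →ₗ[ℝ] ℝ)
  have hT : ∀ n k, T n k = n (pt (corner k)) := fun n k => rfl
  have hinj : Function.Injective T := fun n n' h => NR_ext_corner fun k => congrFun h k
  have hcl : Topology.IsClosedEmbedding (T : NR → Fin 5 → ℝ) := by
    exact LinearMap.isClosedEmbedding_of_injective (𝕜 := ℝ) (E := NR) (F := Fin 5 → ℝ) (f := T)
      (by rw [LinearMap.ker_eq_bot']; exact fun n h => hinj (h.trans (map_zero T).symm))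
  have hIcc : IsCompact (Set.Icc (fun k => -w (corner k)) fun _ : Fin 5 => ∑ k, w (corner k)) :=
    isCompact_Icc
  have hclosed : IsClosed (DeltaW w) := by rw [DeltaW_eq hpos]; exact isClosed_polyhedron _
  refine (hcl.isCompact_preimage hIcc).of_isClosed_subset hclosed fun n hn => ?_
  have hlow : ∀ k, -w (corner k) ≤ n (pt (corner k)) := fun k => by
    have : 0 ≤ n (pt (corner k)) + w (corner k) := hn (corner k)
    linarith
  refine ⟨hlow, fun k => ?_⟩
  rw [hT]
  have h0 : ∑ j, n (pt (corner j)) = 0 := by rw [← map_sum, sum_pt_corner, map_zero]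
  have h1 : ∑ j, n (pt (corner j)) = n (pt (corner k)) +
      ∑ j ∈ Finset.univ.erase k, n (pt (corner j)) := by
    exact (Finset.add_sum_erase _ (fun j => n (pt (corner j))) (Finset.mem_univ k)).symm
  have h2 : ∑ j ∈ Finset.univ.erase k, -w (corner j) ≤
      ∑ j ∈ Finset.univ.erase k, n (pt (corner j)) := Finset.sum_le_sum fun j _ => hlow j
  have h3 : ∑ j ∈ Finset.univ.erase k, w (corner j) ≤ ∑ j, w (corner j) :=
    Finset.sum_le_sum_of_subset_of_nonneg (Finset.erase_subset _ _) fun j _ _ => (hpos _).le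
  rw [Finset.sum_neg_distrib] at h2
  linarith

theorem dualVertex_mem (hpos : ∀ a, 0 < w a) (a : Delta0) :
    dualVertex w a ∈ dualInM (DeltaW w) := fun n hn => (ell_nonneg_iff hpos a n).1 (hn a)

/-- The bipolar argument: a point outside the hull is separated from it by a functional, which after
rescaling lies in `Δ_w`. -/
theorem dualInM_DeltaW (hpos : ∀ a, 0 < w a) :
    dualInM (DeltaW w) = convexHull ℝ (Set.range (dualVertex w)) := by
  refine Set.Subset.antisymm (fun m hm => ?_) (convexHull_min ?_ ?_)
  · by_contra hn
    have hcl : IsClosed (convexHull ℝ (Set.range (dualVertex w))) :=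
      ((Set.finite_range _).isCompact_convexHull ℝ).isClosed
    obtain ⟨n, s, h1, h2⟩ := geometric_hahn_banach_point_closed (convex_convexHull ℝ _) hcl hn
    have h3 : ∀ a, s < n (dualVertex w a) := fun a => h2 _ (subset_convexHull ℝ _ ⟨a, rfl⟩)
    -- Otherwise `n` would be positive at all five corners, although they sum to zero.
    have hs : s < 0 := by
      by_contra! hs
      have h0 : ∑ k, n (pt (corner k)) = 0 := by rw [← map_sum, sum_pt_corner, map_zero]
      have h4 : 0 < ∑ k, n (pt (corner k)) := Finset.sum_pos (fun k _ => by
        have := hs.trans_lt (h3 (corner k))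
        rw [apply_dualVertex] at this
        exact (mul_pos_iff_of_pos_left (inv_pos.2 (hpos _))).1 this) Finset.univ_nonempty
      linarith
    have hmem : (-s)⁻¹ • n ∈ DeltaW w := fun a => by
      rw [ell_nonneg_iff hpos]
      have := h3 a
      simp only [smul_apply, smul_eq_mul]
      rw [← div_eq_inv_mul, le_div_iff₀ (neg_pos.2 hs)]
      linarith
    have := hm _ hmem
    simp only [smul_apply, smul_eq_mul] at this
    rw [← div_eq_inv_mul, le_div_iff₀ (neg_pos.2 hs)] at this
    linarith
  · rintro _ ⟨a, rfl⟩
    exact dualVertex_mem hpos a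
  · have : dualInM (DeltaW w) = ⋂ n ∈ DeltaW w, {m | -1 ≤ n m} := by
      ext; simp [dualInM]
    rw [this]
    exact convex_iInter₂ fun n _ => convex_halfSpace_ge n.toLinearMap.isLinear _

theorem isCompact_dualInM_DeltaW (hpos : ∀ a, 0 < w a) : IsCompact (dualInM (DeltaW w)) := by
  rw [dualInM_DeltaW hpos]
  exact (Set.finite_range _).isCompact_convexHull ℝ

theorem mem_dualInM {P : Set NR} {m : MR} : m ∈ dualInM P ↔ ∀ n ∈ P, -1 ≤ n m := Iff.rfl

theorem convexHull_extremePoints_DeltaW (hpos : ∀ a, 0 < w a) :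
    convexHull ℝ ((DeltaW w).extremePoints ℝ) = DeltaW w := by
  have h := DeltaW_eq hpos
  have h1 : Convex ℝ (DeltaW w) := h ▸ convex_polyhedron _
  have h2 : ((DeltaW w).extremePoints ℝ).Finite := h ▸ finite_extremePoints_polyhedron _
  exact convexHull_extremePoints_eq (E := NR) (isCompact_DeltaW hpos) h1 h2

theorem dualInM_DeltaW_eq_polyhedron (hpos : ∀ a, 0 < w a) :
    dualInM (DeltaW w) = polyhedron fun v : (DeltaW w).extremePoints ℝ => v.1 := by
  ext m
  rw [mem_polyhedron, mem_dualInM]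
  refine ⟨fun h v => h v.1 (extremePoints_subset v.2), fun h n hn => ?_⟩
  rw [← convexHull_extremePoints_DeltaW hpos] at hn
  have hsub : convexHull ℝ ((DeltaW w).extremePoints ℝ) ⊆ {n | -1 ≤ evalM m n} :=
    convexHull_min (fun v hv => h ⟨v, hv⟩)
      (convex_halfSpace_ge (evalM m).toLinearMap.isLinear _)
  exact hsub hn

/-- The face of `P` dual to a subset of its dual polytope. -/
def dualFaceN (P : Set NR) (B : Set MR) : Set NR := {n | n ∈ P ∧ ∀ m ∈ B, n m = -1}

/-! ### Dual faces and the inclusion-reversing bijection of faces. -/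

section Faces

variable {ι κ : Type*} [Finite ι] [Finite κ]

theorem exists_mem_dualInM_of_isProperFace {f : ι → StrongDual ℝ NR} {A : Set NR}
    (hA : IsProperFace (polyhedron f) A) :
    ∃ m ∈ dualInM (polyhedron f), A = {n | n ∈ polyhedron f ∧ n m = -1} := by
  obtain ⟨l, hl, hA⟩ := hA.exists_functional
  obtain ⟨m, rfl⟩ := exists_eq_evalM l
  exact ⟨m, hl, hA⟩

/-- A point of the dual polytope pairing to the least value `-1` with the barycenter does so with
the whole face. The dual face is thus cut out by one functional, the barycenter itself. -/
theorem dualFace_eq {f : ι → StrongDual ℝ NR} (hc : IsCompact (polyhedron f : Set NR)) {A : Set NR}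
    (hA : IsProperFace (polyhedron f) A) :
    dualFace (polyhedron f) A =
      {m | m ∈ dualInM (polyhedron f) ∧ barycenter A m = -1} := by
  ext m
  refine and_congr_right fun hm => ⟨fun h => h _ (hA.barycenter_mem hc), fun h => ?_⟩
  exact hA.eq_of_barycenter hc (evalM m : NR →ₗ[ℝ] ℝ) (fun n hn => hm n (hA.subset hn)) h

theorem isFaceDuality_dualFace {f : ι → StrongDual ℝ NR} (hf : IsCompact (polyhedron f : Set NR))
    {g : κ → StrongDual ℝ MR} (hg : dualInM (polyhedron f) = polyhedron g) :
    IsFaceDuality (polyhedron f) (polyhedron g) (dualFace (polyhedron f))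
      (dualFaceN (polyhedron f)) where
  isProperFace A hA := by
    obtain ⟨m, hm, hAm⟩ := exists_mem_dualInM_of_isProperFace hA
    have hb := hA.barycenter_mem hf
    rw [dualFace_eq hf hA, hg]
    refine isProperFace_of_functional (a := m) (fun x hx => ?_) (hg ▸ hm) ?_
    · rw [← hg] at hx
      exact hx _ (hA.subset hb)
    · have : barycenter A ∈ {n | n ∈ polyhedron f ∧ n m = -1} := hAm ▸ hb
      exact this.2
  -- The point `m` whose functional cuts out `A` belongs to the dual face, so dualizing twice adds
  -- nothing to `A`.
  left_inv A hA := by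
    obtain ⟨m, hm, hAm⟩ := exists_mem_dualInM_of_isProperFace hA
    refine Set.Subset.antisymm (fun n hn => ?_) fun n hn => ⟨hA.subset hn, fun m hm => hm.2 n hn⟩
    rw [hAm]
    exact ⟨hn.1, hn.2 m ⟨hm, fun n' hn' => by rw [hAm] at hn'; exact hn'.2⟩⟩
  antitone A B _ _ h m hm := ⟨hm.1, fun n hn => hm.2 n (h hn)⟩

theorem isFaceDuality_dualFaceN {f : ι → StrongDual ℝ NR} {g : κ → StrongDual ℝ MR}
    (hg : IsCompact (polyhedron g)) (hfg : dualInM (polyhedron f) = polyhedron g)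
    (hgf : dualInN (polyhedron g) = polyhedron f) :
    IsFaceDuality (polyhedron g) (polyhedron f) (dualFaceN (polyhedron f))
      (dualFace (polyhedron f)) where
  isProperFace B hB := by
    obtain ⟨n, hn, hBn⟩ := hB.exists_functional
    have hb := hB.barycenter_mem hg
    have heq : dualFaceN (polyhedron f) B =
        {n | n ∈ polyhedron f ∧ evalM (barycenter B) n = -1} := by
      ext n
      refine and_congr_right fun hn => ⟨fun h => h _ hb, fun h => ?_⟩
      rw [← hgf] at hn
      exact hB.eq_of_barycenter hg (n : MR →ₗ[ℝ] ℝ) (fun m hm => hn m (hB.subset hm)) h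
    rw [heq]
    refine isProperFace_of_functional (a := n) (fun x hx => ?_) (hgf ▸ hn) ?_
    · rw [← hgf] at hx
      exact hx _ (hB.subset hb)
    · have : barycenter B ∈ {m | m ∈ polyhedron g ∧ n m = -1} := hBn ▸ hb
      exact this.2
  left_inv B hB := by
    obtain ⟨n, hn, hBn⟩ := hB.exists_functional
    refine Set.Subset.antisymm (fun m hm => ?_) fun m hm =>
      ⟨hfg ▸ hB.subset hm, fun n hn => hn.2 m hm⟩
    rw [hBn]
    refine ⟨hfg ▸ hm.1, hm.2 n ⟨hgf ▸ hn, fun m' hm' => ?_⟩⟩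
    rw [hBn] at hm'
    exact hm'.2
  antitone A B _ _ h m hm := ⟨hm.1, fun n hn => hm.2 n (h hn)⟩

end Faces

theorem dualInN_dualInM_DeltaW (hpos : ∀ a, 0 < w a) :
    dualInN (dualInM (DeltaW w)) = DeltaW w := by
  refine Set.Subset.antisymm (fun n hn a => ?_) fun n hn m hm => hm n hn
  exact (ell_nonneg_iff hpos a n).2 (hn _ (dualVertex_mem hpos a))

/-- The piecewise linear homeomorphism induced by the dual-face barycentric correspondence. -/
theorem exists_dualBarycentric_homeomorph (hpos : ∀ a, 0 < w a) :
    ∃ s : frontier (DeltaW w) ≃ₜ frontier (dualInM (DeltaW w)),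
      IsPiecewiseLinear s ∧ IsDualBarycentric s := by
  have hf := DeltaW_eq hpos
  have hfc := isCompact_DeltaW hpos
  have hg := dualInM_DeltaW_eq_polyhedron hpos
  have hgc := isCompact_dualInM_DeltaW hpos
  have hgf := dualInN_dualInM_DeltaW hpos
  have hfin : Finite ((DeltaW w).extremePoints ℝ) := by
    rw [hf]; exact (finite_extremePoints_polyhedron _).to_subtype
  generalize hv : (fun v : (DeltaW w).extremePoints ℝ => v.1) = g at hg
  generalize (DeltaW w).extremePoints ℝ = V at g hg hfin
  clear hv
  generalize DeltaW w = P at *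
  subst hf
  rw [hg] at hgc hgf
  obtain ⟨s, h1, h2⟩ := exists_homeomorph_of_isFaceDuality hfc hgc
    (isFaceDuality_dualFace hfc hg) (isFaceDuality_dualFaceN hgc hg hgf)
  generalize hQ : polyhedron g = Q at *
  subst hg
  exact ⟨s, h1, fun x hx => exists_flag_mem_convexHull hfc hx, h2⟩


/-! ### Integral points, simplices of `Z`, and active sets on `Δ_w`. -/

theorem pt_injective : Function.Injective pt := by
  intro a b h
  refine Subtype.ext (funext fun i => ?_)
  have h1 : (pt a).1 i = (pt b).1 i := by rw [h]
  simp only [pt_apply, sub_left_inj] at h1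
  exact_mod_cast h1

theorem neg_one_le_pt (a : Delta0) (i : Fin 5) : -1 ≤ (pt a).1 i := by
  rw [pt_apply]
  have : (0 : ℝ) ≤ a.1 i := by positivity
  linarith

theorem pt_eq_neg_one_iff (a : Delta0) (i : Fin 5) : (pt a).1 i = -1 ↔ a.1 i = 0 := by
  rw [pt_apply]
  constructor
  · intro h
    have : (a.1 i : ℝ) = 0 := by linarith
    exact_mod_cast this
  · intro h
    simp [h]

theorem Delta0_exists_zero (a : Delta0) : ∃ i j, i ≠ j ∧ a.1 i = 0 ∧ a.1 j = 0 :=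
  (Finset.mem_filter.1 a.2).2

theorem pt_mem_twoSkeleton (a : Delta0) : pt a ∈ twoSkeleton := by
  obtain ⟨i, j, hij, hi, hj⟩ := Delta0_exists_zero a
  exact ⟨neg_one_le_pt a, i, j, hij, (pt_eq_neg_one_iff a i).2 hi, (pt_eq_neg_one_iff a j).2 hj⟩

theorem MR_sum_apply {α : Type*} (s : Finset α) (c : α → ℝ) (v : α → MR) (i : Fin 5) :
    (∑ a ∈ s, c a • v a).1 i = ∑ a ∈ s, c a * (v a).1 i := by
  simp [Finset.sum_apply]

/-- A convex combination of integral points with vanishing `i`-th exponent has vanishing `i`-th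
exponent, and conversely. -/
theorem combination_eq_neg_one_iff {t : Delta0 → ℝ} (h0 : ∀ a, 0 ≤ t a) (h1 : ∑ a, t a = 1)
    (i : Fin 5) : (∑ a, t a • pt a).1 i = -1 ↔ ∀ a, t a ≠ 0 → a.1 i = 0 := by
  have h2 : (∑ a, t a • pt a).1 i + 1 = ∑ a, t a * (a.1 i : ℝ) := by
    rw [MR_sum_apply]
    simp only [pt_apply, mul_sub, mul_one, Finset.sum_sub_distrib, h1]
    ring
  rw [← add_eq_zero_iff_eq_neg, h2, Finset.sum_eq_zero_iff_of_nonneg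
    fun a _ => mul_nonneg (h0 a) (by positivity)]
  refine ⟨fun h a ha => ?_, fun h a _ => ?_⟩
  · have := (mul_eq_zero.1 (h a (Finset.mem_univ a))).resolve_left ha
    exact_mod_cast this
  · by_cases ha : t a = 0
    · simp [ha]
    · simp [h a ha]

variable {w : Delta0 → ℝ} {Z : Geometry.SimplicialComplex ℝ MR}

theorem exists_pt_eq (hZ : IsIntegralDecomposition Z) {σ : Finset MR} (hσ : σ ∈ Z.faces) {m : MR}
    (hm : m ∈ σ) : ∃ a, pt a = m := by
  have h1 : m ∈ Z.vertices :=
    Z.down_closed hσ (Finset.singleton_subset_iff.2 hm) (Finset.singleton_nonempty m)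
  rw [hZ.2] at h1
  exact h1

theorem singleton_pt_mem (hZ : IsIntegralDecomposition Z) (a : Delta0) : {pt a} ∈ Z.faces := by
  have h1 : pt a ∈ Z.vertices := by rw [hZ.2]; exact ⟨a, rfl⟩
  exact h1

theorem exists_combination_of_mem_convexHull (hZ : IsIntegralDecomposition Z) {σ : Finset MR}
    (hσ : σ ∈ Z.faces) {x : MR} (hx : x ∈ convexHull ℝ (σ : Set MR)) :
    ∃ t : Delta0 → ℝ, (∀ a, 0 ≤ t a) ∧ ∑ a, t a = 1 ∧ ∑ a, t a • pt a = x ∧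
      ∀ a, t a ≠ 0 → pt a ∈ σ := by
  classical
  have h : (σ : Set MR) = pt '' ((Finset.univ.filter fun a => pt a ∈ σ : Finset Delta0) :
      Set Delta0) := by
    ext m
    constructor
    · intro hm
      obtain ⟨a, rfl⟩ := exists_pt_eq hZ hσ hm
      exact ⟨a, by simpa using hm, rfl⟩
    · rintro ⟨a, ha, rfl⟩
      simpa using ha
  rw [h, mem_convexHull_image_iff] at hx
  obtain ⟨t, h1, h2, h3⟩ := hx
  refine ⟨fun a => if pt a ∈ σ then t a else 0, fun a => ?_, ?_, ?_, fun a ha => ?_⟩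
  · dsimp only
    split_ifs with ha
    · exact h1 a (by simpa using ha)
    · exact le_rfl
  · rw [← h2, Finset.sum_filter]
  · rw [← h3, Finset.sum_filter]
    simp only [ite_smul, zero_smul]
  · by_contra hn
    simp [hn] at ha

theorem combination_mem_convexHull {σ : Finset MR} {t : Delta0 → ℝ} (h0 : ∀ a, 0 ≤ t a)
    (h1 : ∑ a, t a = 1) (hσ : ∀ a, t a ≠ 0 → pt a ∈ σ) :
    ∑ a, t a • pt a ∈ convexHull ℝ (σ : Set MR) := by
  classical
  have e : ∑ a, t a • pt a = ∑ a with t a ≠ 0, t a • pt a := by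
    rw [Finset.sum_filter_of_ne]
    intro a _ h h'
    simp [h'] at h
  have e' : ∑ a with t a ≠ 0, t a = 1 := by
    rw [Finset.sum_filter_of_ne, h1]
    intro a _ h
    exact h
  rw [e]
  exact (convex_convexHull ℝ _).sum_mem (fun a _ => h0 a) e' fun a ha =>
    subset_convexHull ℝ _ (hσ a (Finset.mem_filter.1 ha).2)

open Classical in
/-- The weights of the barycenter of finitely many integral points. -/
def uniformWeight (S : Finset Delta0) (a : Delta0) : ℝ := if a ∈ S then (S.card : ℝ)⁻¹ else 0

theorem uniformWeight_nonneg (S : Finset Delta0) (a : Delta0) : 0 ≤ uniformWeight S a := by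
  unfold uniformWeight
  split_ifs <;> positivity

theorem sum_uniformWeight_smul {F : Type*} [AddCommGroup F] [Module ℝ F] (S : Finset Delta0)
    (v : Delta0 → F) : ∑ a, uniformWeight S a • v a = (S.card : ℝ)⁻¹ • ∑ a ∈ S, v a := by
  simp only [uniformWeight, ite_smul, zero_smul]
  rw [Finset.sum_ite_mem, Finset.univ_inter, Finset.smul_sum]

theorem sum_uniformWeight {S : Finset Delta0} (hS : S.Nonempty) :
    ∑ a, uniformWeight S a = 1 := by
  have hpos : (S.card : ℝ) ≠ 0 := by exact_mod_cast hS.card_pos.ne'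
  have h := sum_uniformWeight_smul S fun _ => (1 : ℝ)
  simpa [hpos] using h

theorem uniformWeight_ne_zero_iff {S : Finset Delta0} {a : Delta0} :
    uniformWeight S a ≠ 0 ↔ a ∈ S := by
  unfold uniformWeight
  split_ifs with h
  · have : (S.card : ℝ) ≠ 0 := by exact_mod_cast (Finset.card_pos.2 ⟨a, h⟩).ne'
    simp [h, this]
  · simp [h]

/-- The vertices of a simplex of `Z` lie in a common two-face of `Δ`. -/
theorem exists_zero_of_mem_faces (hZ : IsIntegralDecomposition Z) {σ : Finset MR}
    (hσ : σ ∈ Z.faces) : ∃ i j, i ≠ j ∧ ∀ a, pt a ∈ σ → a.1 i = 0 ∧ a.1 j = 0 := by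
  classical
  set S : Finset Delta0 := Finset.univ.filter fun a => pt a ∈ σ with hS
  have hne : S.Nonempty := by
    obtain ⟨m, hm⟩ := Z.nonempty_of_mem_faces hσ
    obtain ⟨a, rfl⟩ := exists_pt_eq hZ hσ hm
    exact ⟨a, by simpa [hS] using hm⟩
  -- The barycenter of the simplex lies in the two-skeleton and has positive weight at each vertex,
  -- so a coordinate equal to `-1` there equals `-1` at every vertex.
  set t := uniformWeight S
  have h0 : ∀ a, 0 ≤ t a := uniformWeight_nonneg S
  have h1 : ∑ a, t a = 1 := sum_uniformWeight hne
  have h2 : ∀ a, t a ≠ 0 ↔ pt a ∈ σ := fun a => by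
    rw [uniformWeight_ne_zero_iff]; simp [hS]
  have hmem := Z.convexHull_subset_space hσ
    (combination_mem_convexHull h0 h1 fun a ha => (h2 a).1 ha)
  rw [hZ.1] at hmem
  obtain ⟨-, i, j, hij, hi, hj⟩ := hmem
  rw [combination_eq_neg_one_iff h0 h1] at hi hj
  exact ⟨i, j, hij, fun a ha => ⟨hi a ((h2 a).2 ha), hj a ((h2 a).2 ha)⟩⟩

open Classical in
/-- The constraints of `Δ_w` that are active at a point. -/
def active (w : Delta0 → ℝ) (y : NR) : Finset Delta0 := Finset.univ.filter fun a => ell w a y = 0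

theorem mem_active {y : NR} {a : Delta0} : a ∈ active w y ↔ ell w a y = 0 := by
  simp [active]

theorem mem_frontier_DeltaW (hpos : ∀ a, 0 < w a) {y : NR} :
    y ∈ frontier (DeltaW w) ↔ y ∈ DeltaW w ∧ (active w y).Nonempty := by
  have h := mem_frontier_polyhedron (f := fun a => evalM (dualVertex w a)) (x := y)
  rw [← DeltaW_eq hpos] at h
  rw [h]
  refine and_congr_right fun _ => exists_congr fun a => ?_
  rw [mem_active, ell_eq_zero_iff hpos]
  rfl

open Classical in
/-- If a positive combination of constraints active at a point lies in the cone over the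
two-skeleton, then those constraints lie in a simplex of `Z`. -/
theorem exists_face_of_combination (hZ : IsIntegralDecomposition Z)
    (hw : IsConvexCompatible Z w) {y : NR} (hy : y ∈ DeltaW w) {c : Delta0 → ℝ}
    (hc : ∀ a, 0 ≤ c a) (hca : ∀ a, c a ≠ 0 → a ∈ active w y) {r : ℝ} (hr : 0 ≤ r) {p : MR}
    (hp : p ∈ twoSkeleton) (hx : ∑ a, c a • pt a = r • p) :
    ∃ τ ∈ Z.faces, ∀ a, c a ≠ 0 → pt a ∈ τ := by
  rw [← hZ.1, Geometry.SimplicialComplex.mem_space_iff] at hp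
  obtain ⟨τ, hτ, hpτ⟩ := hp
  obtain ⟨t, h0, h1, h2, h3⟩ := exists_combination_of_mem_convexHull hZ hτ hpτ
  -- Both `n` and `-y` are bounded by `w` on the integral points; `n` attains it on `τ`, and `-y`
  -- attains it where `c` is nonzero. Comparing them at `∑ a, c a • pt a = r • p` gives `∑ a, c a *
  -- (w a - n (pt a)) ≤ 0`, so each point with `c a ≠ 0` is a vertex of `τ`.
  obtain ⟨n, hn⟩ := hw τ hτ
  have hnle : ∀ a, n (pt a) ≤ w a := fun a => by
    by_cases h : pt a ∈ τ
    · exact ((hn a).1 h).le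
    · exact ((hn a).2 h).le
  have e1 : y (∑ a, c a • pt a) = -∑ a, c a * w a := by
    rw [map_sum, ← Finset.sum_neg_distrib]
    refine Finset.sum_congr rfl fun a _ => ?_
    by_cases h : c a = 0
    · simp [h]
    · have : y (pt a) + w a = 0 := mem_active.1 (hca a h)
      rw [map_smul, smul_eq_mul, eq_neg_of_add_eq_zero_left this]
      ring
  have e2 : n p = ∑ a, t a * w a := by
    rw [← h2, map_sum]
    refine Finset.sum_congr rfl fun a _ => ?_
    by_cases h : t a = 0
    · simp [h]
    · rw [map_smul, smul_eq_mul, (hn a).1 (h3 a h)]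
  have e3 : -∑ a, t a * w a ≤ y p := by
    rw [← h2, map_sum, ← Finset.sum_neg_distrib]
    refine Finset.sum_le_sum fun a _ => ?_
    have : 0 ≤ y (pt a) + w a := hy a
    have := mul_nonneg (h0 a) this
    rw [map_smul, smul_eq_mul]
    linarith
  have e4 : n (∑ a, c a • pt a) = ∑ a, c a * n (pt a) := by simp
  have e5 : 0 ≤ ∑ a, c a * (w a - n (pt a)) :=
    Finset.sum_nonneg fun a _ => mul_nonneg (hc a) (sub_nonneg.2 (hnle a))
  have e6 : ∑ a, c a * (w a - n (pt a)) = 0 := by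
    refine le_antisymm ?_ e5
    simp only [mul_sub, Finset.sum_sub_distrib]
    rw [← e4]
    rw [hx, map_smul, smul_eq_mul] at e1 ⊢
    rw [e2]
    have := mul_le_mul_of_nonneg_left e3 hr
    linarith
  refine ⟨τ, hτ, fun a ha => ?_⟩
  have h4 := (Finset.sum_eq_zero_iff_of_nonneg fun a _ =>
    mul_nonneg (hc a) (sub_nonneg.2 (hnle a))).1 e6 a (Finset.mem_univ a)
  have h5 := (mul_eq_zero.1 h4).resolve_left ha
  by_contra hn'
  have := (hn a).2 hn'
  linarith

open Classical in
/-- If the constraints active at a point lie in a two-face of `Δ`, they form a simplex of `Z`. -/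
theorem active_image_mem_faces (hZ : IsIntegralDecomposition Z)
    (hw : IsConvexCompatible Z w) {y : NR} (hy : y ∈ DeltaW w) (hne : (active w y).Nonempty)
    {i j : Fin 5} (hij : i ≠ j) (h : ∀ a ∈ active w y, a.1 i = 0 ∧ a.1 j = 0) :
    (active w y).image pt ∈ Z.faces := by
  set S := active w y with hS
  set t := uniformWeight S
  have h0 : ∀ a, 0 ≤ t a := uniformWeight_nonneg S
  have h1 : ∑ a, t a = 1 := sum_uniformWeight hne
  have h2 : ∀ a, t a ≠ 0 ↔ a ∈ S := fun a => uniformWeight_ne_zero_iff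
  have hp : ∑ a, t a • pt a ∈ twoSkeleton := by
    refine ⟨fun k => ?_, i, j, hij, ?_, ?_⟩
    · rw [MR_sum_apply, ← h1, ← Finset.sum_neg_distrib]
      refine Finset.sum_le_sum fun a _ => ?_
      have := mul_le_mul_of_nonneg_left (neg_one_le_pt a k) (h0 a)
      linarith
    · rw [combination_eq_neg_one_iff h0 h1]
      exact fun a ha => (h a ((h2 a).1 ha)).1
    · rw [combination_eq_neg_one_iff h0 h1]
      exact fun a ha => (h a ((h2 a).1 ha)).2
  obtain ⟨τ, hτ, hmem⟩ := exists_face_of_combination hZ hw hy h0 (fun a ha => (h2 a).1 ha)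
    zero_le_one hp (one_smul ℝ _).symm
  refine Z.down_closed hτ ?_ (hne.image pt)
  intro m hm
  obtain ⟨a, ha, rfl⟩ := Finset.mem_image.1 hm
  exact hmem a ((h2 a).2 ha)

/-- The constraints active at a boundary point lie in a facet of `Δ`. -/
theorem exists_zero_of_active (hZ : IsIntegralDecomposition Z)
    (hw : IsConvexCompatible Z w) {y : NR} (hy : y ∈ DeltaW w) :
    ∃ i, ∀ a ∈ active w y, a.1 i = 0 := by
  classical
  by_contra! hcon
  set S := active w y with hS
  -- To the sum `q` of the active points, a multiple of one active point `m` is added until two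
  -- coordinates tie for the smallest. The result is in the cone over the two-skeleton and uses
  -- every active point with positive weight, so all of them lie in one simplex of `Z`.
  set q : MR := ∑ a ∈ S, pt a with hq
  obtain ⟨i, -, hi⟩ := Finset.exists_min_image Finset.univ (fun i => q.1 i) Finset.univ_nonempty
  have hi : ∀ j, q.1 i ≤ q.1 j := fun j => hi j (Finset.mem_univ j)
  obtain ⟨m, hm, hmi⟩ := hcon i
  have hmi' : 0 < (m.1 i : ℝ) := by exact_mod_cast Nat.pos_of_ne_zero hmi
  set J : Finset (Fin 5) := Finset.univ.filter fun j => m.1 j < m.1 i with hJ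
  have hJne : J.Nonempty := by
    obtain ⟨j, -, -, hj, -⟩ := Delta0_exists_zero m
    exact ⟨j, by simp [hJ, hj, Nat.pos_of_ne_zero hmi]⟩
  obtain ⟨j, hj, hjmin⟩ := Finset.exists_min_image J
    (fun j => (q.1 j - q.1 i) / ((m.1 i : ℝ) - m.1 j)) hJne
  have hJpos : ∀ k ∈ J, 0 < (m.1 i : ℝ) - m.1 k := fun k hk => by
    have : m.1 k < m.1 i := by simpa [hJ] using hk
    have : (m.1 k : ℝ) < m.1 i := by exact_mod_cast this
    linarith
  -- The coordinates in `J` are those that decrease relative to the `i`-th when `m` is added; `s` is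
  -- the first multiple at which one of them meets it.
  set s : ℝ := (q.1 j - q.1 i) / ((m.1 i : ℝ) - m.1 j) with hs
  have hs0 : 0 ≤ s := div_nonneg (sub_nonneg.2 (hi j)) (hJpos j hj).le
  set c : Delta0 → ℝ := fun a => if a ∈ S then (if a = m then 1 + s else 1) else 0 with hc
  have hc0 : ∀ a, 0 ≤ c a := fun a => by
    simp only [hc]; split_ifs <;> positivity
  have hcS : ∀ a, c a ≠ 0 ↔ a ∈ S := fun a => by
    simp only [hc]
    split_ifs with h1 h2
    · simp [h1]; positivity
    · simp [h1]
    · simp [h1]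
  set x : MR := ∑ a, c a • pt a with hx
  have hxq : x = q + s • pt m := by
    have : ∀ a, c a • pt a = (if a ∈ S then pt a else 0) + if a = m then s • pt m else 0 := by
      intro a
      simp only [hc]
      split_ifs with h1 h2 h2
      · rw [h2, add_smul, one_smul]
      · simp
      · exact (h1 (h2 ▸ hm)).elim
      · simp
    rw [hx, Finset.sum_congr rfl fun a _ => this a, Finset.sum_add_distrib,
      Finset.sum_ite_mem, Finset.univ_inter, Finset.sum_ite_eq' Finset.univ m fun _ => s • pt m,
      if_pos (Finset.mem_univ m)]
  have hxk : ∀ k, x.1 k = q.1 k + s * ((m.1 k : ℝ) - 1) := fun k => by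
    rw [hxq]
    simp [pt_apply]
  have hxi : ∀ k, x.1 i ≤ x.1 k := fun k => by
    rw [hxk, hxk]
    by_cases hk : k ∈ J
    · have h1 := hjmin k hk
      rw [le_div_iff₀ (hJpos k hk)] at h1
      linarith
    · have h1 : (m.1 i : ℝ) ≤ m.1 k := by
        have : m.1 i ≤ m.1 k := by simpa [hJ] using hk
        exact_mod_cast this
      have := mul_le_mul_of_nonneg_left h1 hs0
      linarith [hi k]
  have hxij : x.1 j = x.1 i := by
    rw [hxk, hxk]
    have : s * ((m.1 i : ℝ) - m.1 j) = q.1 j - q.1 i := div_mul_cancel₀ _ (hJpos j hj).ne'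
    linarith
  have hij : i ≠ j := fun h => by
    have := hJpos j hj
    rw [h] at this
    linarith
  have hsum := MR_sum_eq_zero x
  have hxi0 : x.1 i ≤ 0 := by
    have : ∑ _k : Fin 5, x.1 i ≤ ∑ k, x.1 k := Finset.sum_le_sum fun k _ => hxi k
    rw [hsum] at this
    simp at this
    linarith
  have hface : ∃ τ ∈ Z.faces, ∀ a, c a ≠ 0 → pt a ∈ τ := by
    -- If the smallest coordinate is zero, then `x` is the apex of the cone, which is covered by `r
    -- = 0`.
    rcases hxi0.eq_or_lt with h0 | h0
    · have hx0 : x = 0 := by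
        ext k
        have := (Finset.sum_eq_zero_iff_of_nonneg fun k _ => by
          have := hxi k; rw [h0] at this; exact this).1 hsum k (Finset.mem_univ k)
        simpa using this
      refine exists_face_of_combination hZ hw hy hc0 (fun a ha => (hcS a).1 ha) le_rfl
        (pt_mem_twoSkeleton m) ?_
      rw [zero_smul]
      exact hx0
    · have hr : 0 < -x.1 i := neg_pos.2 h0
      refine exists_face_of_combination hZ hw hy hc0 (fun a ha => (hcS a).1 ha) hr.le
        (p := (-x.1 i)⁻¹ • x) ?_ (smul_inv_smul₀ hr.ne' x).symm
      have hval : ∀ k, ((-x.1 i)⁻¹ • x).1 k = x.1 k / (-x.1 i) := fun k => by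
        simp [div_eq_inv_mul]
      refine ⟨fun k => ?_, i, j, hij, ?_, ?_⟩
      · rw [hval, le_div_iff₀ hr]
        linarith [hxi k]
      · rw [hval, div_eq_iff hr.ne']
        ring
      · rw [hval, hxij, div_eq_iff hr.ne']
        ring
  obtain ⟨τ, hτ, hmem⟩ := hface
  obtain ⟨k, _, _, hk⟩ := exists_zero_of_mem_faces hZ hτ
  obtain ⟨a, ha, hak⟩ := hcon k
  exact hak (hk a (hmem a ((hcS a).2 ha))).1

/-! ### The blow-down and the vertices of `Δ^∨` -/

theorem sectionN_nonneg {y : NR} (hy : y ∈ DeltaW w) (i : Fin 5) : 0 ≤ sectionN w i y :=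
  Finset.prod_nonneg fun a _ => pow_nonneg (hy a) _

theorem sectionN_eq_zero_iff {y : NR} (i : Fin 5) :
    sectionN w i y = 0 ↔ ∃ a ∈ active w y, a.1 i ≠ 0 := by
  simp [sectionN, Finset.prod_eq_zero_iff, mem_active]

theorem sectionZero_eq_zero {y : NR} (hne : (active w y).Nonempty) : sectionZero w y = 0 := by
  obtain ⟨a, ha⟩ := hne
  exact Finset.prod_eq_zero (Finset.mem_univ a) (mem_active.1 ha)

theorem nVertex_mem (i : Fin 5) : nVertex i ∈ dualInN Delta := fun _ hm => hm i

theorem nVertex_injective : Function.Injective nVertex := by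
  intro i j h
  by_contra hij
  have := congrArg (fun n : NR => n (pt (corner i))) h
  simp only [nVertex_apply, pt_corner_apply] at this
  simp [Ne.symm hij] at this

theorem sum_smul_nVertex_mem {s : Finset (Fin 5)} {c : Fin 5 → ℝ} (h0 : ∀ k, 0 ≤ c k)
    (h1 : ∑ k ∈ s, c k = 1) : ∑ k ∈ s, c k • nVertex k ∈ dualInN Delta := by
  intro m hm
  rw [sum_apply, ← h1, ← Finset.sum_neg_distrib]
  refine Finset.sum_le_sum fun k _ => ?_
  have := mul_le_mul_of_nonneg_left (hm k) (h0 k)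
  rw [smul_apply, smul_eq_mul, nVertex_apply]
  linarith

/-- At the four corners other than the `i`-th, `nVertex i` takes the least value allowed on `Δ^∨`,
so the ends of a segment through it do too. Values at four corners determine a functional. -/
theorem nVertex_mem_extremePoints (i : Fin 5) : nVertex i ∈ (dualInN Delta).extremePoints ℝ := by
  refine ⟨nVertex_mem i, ?_⟩
  rintro x hx y hy ⟨a, b, ha, hb, hab, hxy⟩
  have hcorner : ∀ k, pt (corner k) ∈ Delta := fun k => neg_one_le_pt _
  have hne : ∀ k, k ≠ i → x (pt (corner k)) = -1 := fun k hk => by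
    have h1 := hx _ (hcorner k)
    have h2 := hy _ (hcorner k)
    have h3 := congrArg (fun n : NR => n (pt (corner k))) hxy
    simp only [add_apply, smul_apply, smul_eq_mul,
      nVertex_apply, pt_corner_apply, if_neg (Ne.symm hk)] at h3
    nlinarith
  have hsum : ∀ n : NR, n (pt (corner i)) = -∑ k ∈ Finset.univ.erase i, n (pt (corner k)) := by
    intro n
    have h0 : ∑ j, n (pt (corner j)) = 0 := by rw [← map_sum, sum_pt_corner, map_zero]
    rw [← Finset.add_sum_erase _ (fun j => n (pt (corner j))) (Finset.mem_univ i)] at h0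
    exact eq_neg_of_add_eq_zero_left h0
  have hoff : ∀ k, k ≠ i → x (pt (corner k)) = nVertex i (pt (corner k)) := fun k hk => by
    rw [hne k hk, nVertex_apply, pt_corner_apply, if_neg (Ne.symm hk)]
    norm_num
  refine NR_ext_corner fun k => ?_
  by_cases hk : k = i
  · subst hk
    rw [hsum, hsum (nVertex k)]
    congr 1
    exact Finset.sum_congr rfl fun j hj => hoff j (Finset.ne_of_mem_erase hj)
  · exact hoff k hk

/-- A convex combination of the `nⁱ` that is an extreme point of `Δ^∨` is equal to each `nⁱ`
occurring in it. -/
theorem eq_nVertex_of_extreme {l : Fin 5 → ℝ} (h0 : ∀ i, 0 ≤ l i) (h1 : ∑ i, l i = 1)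
    (hext : ∑ i, l i • nVertex i ∈ (dualInN Delta).extremePoints ℝ) {i : Fin 5} (hi : l i ≠ 0) :
    nVertex i = ∑ i, l i • nVertex i := by
  classical
  have hadd : l i + ∑ k ∈ Finset.univ.erase i, l k = 1 := by
    rw [Finset.add_sum_erase _ _ (Finset.mem_univ i), h1]
  have hsum : l i • nVertex i + ∑ k ∈ Finset.univ.erase i, l k • nVertex k =
      ∑ i, l i • nVertex i :=
    Finset.add_sum_erase _ (fun i => l i • nVertex i) (Finset.mem_univ i)
  have hr0 : 0 ≤ ∑ k ∈ Finset.univ.erase i, l k := Finset.sum_nonneg fun k _ => h0 k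
  rcases hr0.eq_or_lt with hr | hr
  · have hz := (Finset.sum_eq_zero_iff_of_nonneg fun k _ => h0 k).1 hr.symm
    have hli : l i = 1 := by linarith
    rw [← hsum, hli, one_smul, Finset.sum_eq_zero fun k hk => by rw [hz k hk, zero_smul], add_zero]
  · set r := ∑ k ∈ Finset.univ.erase i, l k with hrdef
    have hq : r⁻¹ • ∑ k ∈ Finset.univ.erase i, l k • nVertex k ∈ dualInN Delta := by
      rw [Finset.smul_sum]
      simp only [smul_smul]
      refine sum_smul_nVertex_mem (fun k => mul_nonneg (inv_nonneg.2 hr0) (h0 k)) ?_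
      rw [← Finset.mul_sum, inv_mul_cancel₀ hr.ne']
    refine hext.2 (nVertex_mem i) hq ⟨l i, r, (h0 i).lt_of_ne' hi, hr, hadd, ?_⟩
    rw [smul_inv_smul₀ hr.ne', hsum]

open Classical in
/-- The points of the boundary of `Δ_w` that are not mapped to a vertex of `Δ^∨` are those whose
active constraints form a simplex of `Z`. -/
theorem blowdown_notMem_extremePoints_iff (hpos : ∀ a, 0 < w a) (hZ : IsIntegralDecomposition Z)
    (hw : IsConvexCompatible Z w) {y : NR} (hy : y ∈ frontier (DeltaW w)) :
    blowdown w y ∉ (dualInN Delta).extremePoints ℝ ↔ (active w y).image pt ∈ Z.faces := by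
  obtain ⟨hyD, hne⟩ := (mem_frontier_DeltaW hpos).1 hy
  obtain ⟨i, hi⟩ := exists_zero_of_active hZ hw hyD
  have hsi : sectionN w i y ≠ 0 := fun h => by
    obtain ⟨a, ha, hai⟩ := (sectionN_eq_zero_iff i).1 h
    exact hai (hi a ha)
  have hz : sectionZero w y = 0 := sectionZero_eq_zero hne
  set T := ∑ i, sectionN w i y with hT
  have hTpos : 0 < T := Finset.sum_pos' (fun k _ => sectionN_nonneg hyD k)
    ⟨i, Finset.mem_univ i, (sectionN_nonneg hyD i).lt_of_ne' hsi⟩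
  -- With `sectionZero` vanishing, the image is a convex combination of the `nVertex k`, whose
  -- weights are positive exactly where the `k`-th exponents of all active points vanish.
  have hb : blowdown w y = ∑ k, (T⁻¹ * sectionN w k y) • nVertex k := by
    rw [blowdown, hz, zero_add, Finset.smul_sum]
    simp only [smul_smul, hT]
  have hl0 : ∀ k, 0 ≤ T⁻¹ * sectionN w k y := fun k =>
    mul_nonneg (inv_nonneg.2 hTpos.le) (sectionN_nonneg hyD k)
  have hl1 : ∑ k, T⁻¹ * sectionN w k y = 1 := by
    rw [← Finset.mul_sum, inv_mul_cancel₀ hTpos.ne']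
  constructor
  · intro h
    by_contra hn
    -- A second surviving section would put the active points in a two-face, where they form a
    -- simplex of `Z`.
    have honly : ∀ k, k ≠ i → sectionN w k y = 0 := fun k hk => by
      by_contra hsk
      refine hn (active_image_mem_faces hZ hw hyD hne (Ne.symm hk) fun a ha => ⟨hi a ha, ?_⟩)
      by_contra hak
      exact hsk ((sectionN_eq_zero_iff k).2 ⟨a, ha, hak⟩)
    refine h ?_
    have hone : T⁻¹ * sectionN w i y = 1 := by
      rw [← hl1, Finset.sum_eq_single i (fun k _ hk => by rw [honly k hk, mul_zero])
        (fun h => (h (Finset.mem_univ i)).elim)]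
    rw [hb, Finset.sum_eq_single i (fun k _ hk => by rw [honly k hk, mul_zero, zero_smul])
      (fun h => (h (Finset.mem_univ i)).elim), hone, one_smul]
    exact nVertex_mem_extremePoints i
  · intro h hext
    obtain ⟨j, k, hjk, hmem⟩ := exists_zero_of_mem_faces hZ h
    have hs : ∀ l : Fin 5, (∀ a ∈ active w y, a.1 l = 0) → T⁻¹ * sectionN w l y ≠ 0 := by
      intro l hl
      refine mul_ne_zero (inv_ne_zero hTpos.ne') fun h0 => ?_
      obtain ⟨a, ha, hal⟩ := (sectionN_eq_zero_iff l).1 h0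
      exact hal (hl a ha)
    have hmem' : ∀ a ∈ active w y, a.1 j = 0 ∧ a.1 k = 0 := fun a ha =>
      hmem a (Finset.mem_image_of_mem pt ha)
    rw [hb] at hext
    have e1 := eq_nVertex_of_extreme hl0 hl1 hext (hs j fun a ha => (hmem' a ha).1)
    have e2 := eq_nVertex_of_extreme hl0 hl1 hext (hs k fun a ha => (hmem' a ha).2)
    exact hjk (nVertex_injective (e1.trans e2.symm))


variable {w : Delta0 → ℝ} {Z : Geometry.SimplicialComplex ℝ MR}

/-! ### Simplices of `Z` and faces of `Δ_w` -/

section Faces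

variable {A B : Set NR}

theorem isCompact_polyhedron_dualVertex (hpos : ∀ a, 0 < w a) :
    IsCompact (polyhedron (fun a => evalM (dualVertex w a)) : Set NR) :=
  DeltaW_eq hpos ▸ isCompact_DeltaW hpos

theorem barycenter_mem_face (hpos : ∀ a, 0 < w a) (hA : IsProperFace (DeltaW w) A) :
    barycenter A ∈ A := by
  rw [DeltaW_eq hpos] at hA
  exact hA.barycenter_mem (isCompact_polyhedron_dualVertex hpos)

theorem mem_face_iff (hpos : ∀ a, 0 < w a) (hA : IsProperFace (DeltaW w) A) {n : NR} :
    n ∈ A ↔ n ∈ DeltaW w ∧ active w (barycenter A) ⊆ active w n := by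
  rw [DeltaW_eq hpos] at hA ⊢
  rw [hA.mem_iff (isCompact_polyhedron_dualVertex hpos)]
  refine and_congr_right fun _ => forall_congr' fun a => ?_
  rw [mem_active, mem_active, ell_eq_zero_iff hpos, ell_eq_zero_iff hpos]
  rfl

theorem active_face_nonempty (hpos : ∀ a, 0 < w a) (hA : IsProperFace (DeltaW w) A) :
    (active w (barycenter A)).Nonempty := by
  rw [DeltaW_eq hpos] at hA
  obtain ⟨a, ha⟩ := hA.exists_active (isCompact_polyhedron_dualVertex hpos)
  exact ⟨a, mem_active.2 ((ell_eq_zero_iff hpos _ _).2 ha)⟩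

theorem barycenter_mem_frontier (hpos : ∀ a, 0 < w a) (hA : IsProperFace (DeltaW w) A) :
    barycenter A ∈ frontier (DeltaW w) :=
  (mem_frontier_DeltaW hpos).2
    ⟨hA.subset (barycenter_mem_face hpos hA), active_face_nonempty hpos hA⟩

theorem face_subset_iff (hpos : ∀ a, 0 < w a) (hA : IsProperFace (DeltaW w) A)
    (hB : IsProperFace (DeltaW w) B) :
    A ⊆ B ↔ active w (barycenter B) ⊆ active w (barycenter A) := by
  refine ⟨fun h => ((mem_face_iff hpos hB).1 (h (barycenter_mem_face hpos hA))).2,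
    fun h n hn => ?_⟩
  have := (mem_face_iff hpos hA).1 hn
  exact (mem_face_iff hpos hB).2 ⟨this.1, h.trans this.2⟩

/-- Every set of constraints that is active at a boundary point belongs to a face. -/
theorem exists_face_of_mem_frontier (hpos : ∀ a, 0 < w a) {y : NR}
    (hy : y ∈ frontier (DeltaW w)) :
    ∃ A, IsProperFace (DeltaW w) A ∧ active w (barycenter A) = active w y := by
  have hc := isCompact_polyhedron_dualVertex hpos
  rw [DeltaW_eq hpos] at hy ⊢
  refine ⟨carrierFace _ y, isProperFace_carrierFace hy, ?_⟩
  ext a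
  rw [mem_active, mem_active, ell_eq_zero_iff hpos, ell_eq_zero_iff hpos]
  exact active_barycenter_carrierFace hc hy a

open Classical in
-- The negative of the supporting function of the simplex works: strictness off the simplex keeps
-- every other constraint inactive.
theorem exists_active_eq (hw : IsConvexCompatible Z w)
    {S : Finset Delta0} (hS : S.image pt ∈ Z.faces) : ∃ y ∈ DeltaW w, active w y = S := by
  obtain ⟨n, hn⟩ := hw _ hS
  have hmem : ∀ a, pt a ∈ S.image pt ↔ a ∈ S := fun a => by
    rw [Finset.mem_image]
    exact ⟨fun ⟨b, hb, h⟩ => pt_injective h ▸ hb, fun h => ⟨a, h, rfl⟩⟩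
  have hell : ∀ a, ell w a (-n) = w a - n (pt a) := fun a => by
    rw [ell, neg_apply]; ring
  refine ⟨-n, fun a => ?_, ?_⟩
  · rw [hell]
    by_cases h : pt a ∈ S.image pt
    · rw [(hn a).1 h, sub_self]
    · exact (sub_pos.2 ((hn a).2 h)).le
  · ext a
    rw [mem_active, hell, ← hmem a]
    by_cases h : pt a ∈ S.image pt
    · simp only [h, (hn a).1 h, sub_self]
    · simp only [h, iff_false]
      exact (sub_pos.2 ((hn a).2 h)).ne'

open Classical in
/-- Every simplex of `Z` is the set of active constraints of a face of `Δ_w`. -/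
theorem exists_face_of_simplex (hpos : ∀ a, 0 < w a) (hw : IsConvexCompatible Z w)
    {S : Finset Delta0} (hS : S.image pt ∈ Z.faces) :
    ∃ A, IsProperFace (DeltaW w) A ∧ active w (barycenter A) = S := by
  obtain ⟨y, hy, rfl⟩ := exists_active_eq hw hS
  refine exists_face_of_mem_frontier hpos ((mem_frontier_DeltaW hpos).2 ⟨hy, ?_⟩)
  exact Finset.image_nonempty.1 (Z.nonempty_of_mem_faces hS)

open Classical in
theorem exists_image_pt_eq (hZ : IsIntegralDecomposition Z) {σ : Finset MR} (hσ : σ ∈ Z.faces) :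
    ∃ S : Finset Delta0, S.image pt = σ := by
  refine ⟨Finset.univ.filter fun a => pt a ∈ σ, ?_⟩
  ext m
  simp only [Finset.mem_image, Finset.mem_filter, Finset.mem_univ, true_and]
  refine ⟨fun ⟨a, ha, h⟩ => h ▸ ha, fun hm => ?_⟩
  obtain ⟨a, rfl⟩ := exists_pt_eq hZ hσ hm
  exact ⟨a, hm, rfl⟩

/-- Since `y` has positive weight, a constraint inactive at `y` stays inactive. Hence a segment from
`x` to `y` has the active set of `y` everywhere except possibly at `x`. -/
theorem active_add_smul {x y : NR} (hxy : active w y ⊆ active w x) {a b : ℝ}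
    (hx : x ∈ DeltaW w) (hy : y ∈ DeltaW w) (ha : 0 ≤ a) (hb : 0 < b) (hab : a + b = 1) :
    active w (a • x + b • y) = active w y := by
  ext m
  have h : ell w m (a • x + b • y) = a * ell w m x + b * ell w m y := by
    simp only [ell, add_apply, smul_apply, smul_eq_mul]
    linear_combination (-w m) * hab
  rw [mem_active, mem_active, h]
  constructor
  · intro h0
    have h1 := mul_nonneg ha (hx m)
    have h2 := mul_nonneg hb.le (hy m)
    exact (mul_eq_zero.1 (show b * ell w m y = 0 by linarith)).resolve_left hb.ne'
  · intro h0
    rw [mem_active.1 (hxy (mem_active.2 h0)), h0]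
    ring

end Faces

/-! ### Linear independence of the vertices of a simplex, and dimensions of faces -/

open Classical in
-- The points share a coordinate equal to `-1`, so any linear relation has total weight zero and
-- affine independence applies.
theorem linearIndepOn_pt (hZ : IsIntegralDecomposition Z) {S : Finset Delta0}
    (hS : S.image pt ∈ Z.faces) : LinearIndepOn ℝ pt (S : Set Delta0) := by
  obtain ⟨i, -, -, hi⟩ : ∃ i j : Fin 5, i ≠ j ∧ _ := by
    obtain ⟨i, j, h, hij⟩ := exists_zero_of_mem_faces hZ hS
    exact ⟨i, j, h, fun a (ha : a ∈ S) => (hij a (Finset.mem_image_of_mem pt ha)).1⟩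
  rw [linearIndepOn_finset_iff]
  intro g hg
  have hsum : ∑ a ∈ S, g a = 0 := by
    have h := congrArg (fun m : MR => m.1 i) hg
    simp only [MR_sum_apply] at h
    rw [Finset.sum_congr rfl fun a ha => by rw [(pt_eq_neg_one_iff a i).2 (hi a ha)]] at h
    simpa using h
  let e : S ↪ (S.image pt : Finset MR) :=
    ⟨fun a => ⟨pt a.1, Finset.mem_image_of_mem pt a.2⟩, fun a b h =>
      Subtype.ext (pt_injective (congrArg Subtype.val h))⟩
  have hind : AffineIndependent ℝ (fun a : S => pt a.1) := (Z.indep hS).comp_embedding e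
  rw [affineIndependent_iff] at hind
  have := hind Finset.univ (fun a => g a.1) (by rw [Finset.sum_coe_sort S g]; exact hsum)
    (by rw [Finset.sum_coe_sort S fun a => g a • pt a]; exact hg)
  exact fun a ha => this ⟨a, ha⟩ (Finset.mem_univ _)

theorem finrank_MR : Module.finrank ℝ MR = 4 := by
  let φ : (Fin 5 → ℝ) →ₗ[ℝ] ℝ := ∑ i, LinearMap.proj i
  have hφ : ∀ x, φ x = ∑ i, x i := fun x => by simp [φ]
  have hker : LinearMap.ker φ = sumZero := by
    ext x
    rw [LinearMap.mem_ker, hφ]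
    rfl
  have hsurj : Function.Surjective φ := fun c => ⟨Pi.single 0 c, by rw [hφ]; simp⟩
  have h := φ.finrank_range_add_finrank_ker
  rw [LinearMap.range_eq_top.2 hsurj, finrank_top, hker] at h
  simp at h
  change Module.finrank ℝ sumZero = 4
  omega

theorem finrank_NR : Module.finrank ℝ NR = 4 := by
  rw [← finrank_MR, ← Subspace.dual_finrank_eq (K := ℝ) (V := MR)]
  exact (LinearMap.toContinuousLinearMap (𝕜 := ℝ) (E := MR) (F' := ℝ)).finrank_eq.symm

/-- Restriction of linear functions to finitely many integral points. -/
def evalOn (S : Finset Delta0) : NR →ₗ[ℝ] (S → ℝ) :=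
  LinearMap.pi fun a => (evalM (pt a.1) : NR →ₗ[ℝ] ℝ)

theorem mem_ker_evalOn {S : Finset Delta0} {n : NR} :
    n ∈ LinearMap.ker (evalOn S) ↔ ∀ a ∈ S, n (pt a) = 0 := by
  rw [LinearMap.mem_ker]
  exact ⟨fun h a ha => congrFun h ⟨a, ha⟩, fun h => funext fun a => h a.1 a.2⟩

open Classical in
theorem evalOn_surjective (hZ : IsIntegralDecomposition Z) {S : Finset Delta0}
    (hS : S.image pt ∈ Z.faces) : Function.Surjective (evalOn S) := by
  have hli : LinearIndependent ℝ (fun a : (S : Set Delta0) => pt a.1) := linearIndepOn_pt hZ hS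
  intro b
  obtain ⟨g, hg⟩ := LinearMap.exists_extend ((Module.Basis.span hli).constr ℝ
    fun a : (S : Set Delta0) => b a)
  refine ⟨LinearMap.toContinuousLinearMap g, funext fun a => ?_⟩
  have h := LinearMap.congr_fun hg (Module.Basis.span hli a)
  rw [Module.Basis.constr_basis] at h
  refine Eq.trans ?_ h
  rw [LinearMap.comp_apply]
  exact congrArg g (congrArg Subtype.val (Module.Basis.span_apply hli a)).symm

open Classical in
theorem finrank_ker_evalOn (hZ : IsIntegralDecomposition Z) {S : Finset Delta0}
    (hS : S.image pt ∈ Z.faces) :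
    S.card + Module.finrank ℝ (LinearMap.ker (evalOn S)) = 4 := by
  have h := LinearMap.finrank_range_add_finrank_ker (K := ℝ) (V := NR) (V₂ := S → ℝ) (evalOn S)
  have hr : LinearMap.range (evalOn S) = ⊤ := LinearMap.range_eq_top.2 (evalOn_surjective hZ hS)
  rw [hr, finrank_top, finrank_NR] at h
  simpa using h

/-- From the barycenter, a short move in any direction annihilated by the active points stays in the
face. -/
theorem vectorSpan_face (hpos : ∀ a, 0 < w a) {A : Set NR} (hA : IsProperFace (DeltaW w) A) :
    vectorSpan ℝ A = LinearMap.ker (evalOn (active w (barycenter A))) := by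
  have hb := barycenter_mem_face hpos hA
  refine le_antisymm (Submodule.span_le.2 ?_) fun d hd => ?_
  · rintro _ ⟨x, hx, y, hy, rfl⟩
    refine mem_ker_evalOn.2 fun a ha => ?_
    have h1 : x (pt a) + w a = 0 := mem_active.1 (((mem_face_iff hpos hA).1 hx).2 ha)
    have h2 : y (pt a) + w a = 0 := mem_active.1 (((mem_face_iff hpos hA).1 hy).2 ha)
    simp only [vsub_eq_sub, sub_apply]
    linarith
  · rw [mem_ker_evalOn] at hd
    have hd' : ∀ a, evalM (dualVertex w a) (barycenter A) = -1 →
        0 ≤ evalM (dualVertex w a) d := fun a ha => by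
      have := hd a (mem_active.2 ((ell_eq_zero_iff hpos _ _).2 ha))
      rw [evalM_apply, apply_dualVertex, this, mul_zero]
    obtain ⟨ε, hε, hm⟩ := exists_pos_add_smul_mem (fun a => evalM (dualVertex w a))
      (x := barycenter A) (by rw [← DeltaW_eq hpos]; exact hA.subset hb) hd'
    rw [← DeltaW_eq hpos] at hm
    have hmA : barycenter A + ε • d ∈ A := (mem_face_iff hpos hA).2 ⟨hm, fun a ha => by
      have h1 : barycenter A (pt a) + w a = 0 := mem_active.1 ha
      have h2 := hd a ha
      rw [mem_active]
      simp only [ell, add_apply, smul_apply, h2, smul_zero, add_zero]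
      exact h1⟩
    have h1 := vsub_mem_vectorSpan ℝ hmA hb
    have h2 : barycenter A + ε • d -ᵥ barycenter A = ε • d := by
      ext m
      simp
    rw [h2] at h1
    exact (Submodule.smul_mem_iff _ hε.ne').1 h1

open Classical in
theorem card_active_add_faceDim (hpos : ∀ a, 0 < w a) (hZ : IsIntegralDecomposition Z)
    {A : Set NR} (hA : IsProperFace (DeltaW w) A)
    (hS : (active w (barycenter A)).image pt ∈ Z.faces) :
    (active w (barycenter A)).card + faceDim A = 4 := by
  rw [faceDim, vectorSpan_face hpos hA]
  exact finrank_ker_evalOn hZ hS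

open Classical in
-- Four independent points would determine a functional on the four-dimensional space, but `nVertex
-- i` and `nVertex j` both equal `-1` on a set in a two-face.
theorem card_le_three (hZ : IsIntegralDecomposition Z) {S : Finset Delta0}
    (hS : S.image pt ∈ Z.faces) : S.card ≤ 3 := by
  obtain ⟨i, j, hij, h⟩ := exists_zero_of_mem_faces hZ hS
  have hle := finrank_ker_evalOn hZ hS
  by_contra hcard
  have hrank : Module.finrank ℝ NR = Module.finrank ℝ (S → ℝ) := by
    rw [finrank_NR, Module.finrank_fintype_fun_eq_card, Fintype.card_coe]
    omega
  have hinj : Function.Injective (evalOn S) :=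
    (LinearMap.injective_iff_surjective_of_finrank_eq_finrank (K := ℝ) (V := NR)
      (V₂ := S → ℝ) hrank).2 (evalOn_surjective hZ hS)
  refine hij (nVertex_injective (hinj (funext fun a => ?_)))
  have := h a.1 (Finset.mem_image_of_mem pt a.2)
  change (pt a.1).1 i = (pt a.1).1 j
  rw [pt_apply, pt_apply, this.1, this.2]

/-! ### Barycentric coordinates -/

/-- Comparing the supporting functions of the two simplices at `x` forces every vertex used by `t'`
into `σ`, where linear independence concludes. This makes `skeletonMap` independent of the choice of
coordinates. -/
theorem coord_unique (hZ : IsIntegralDecomposition Z) (hw : IsConvexCompatible Z w) {x : MR}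
    {t t' : Delta0 → ℝ} (ht : IsBarycentricCoord Z x t) (ht' : IsBarycentricCoord Z x t') :
    t = t' := by
  classical
  obtain ⟨h0, h1, h2, σ, hσ, h3⟩ := ht
  obtain ⟨h0', h1', h2', τ, hτ, h3'⟩ := ht'
  have key : ∀ (n : NR) (σ : Finset MR), (∀ a, (pt a ∈ σ → n (pt a) = w a) ∧
      (pt a ∉ σ → n (pt a) < w a)) → ∀ t : Delta0 → ℝ, (∀ a, t a ≠ 0 → pt a ∈ σ) →
      ∑ a, t a • pt a = x → n x = ∑ a, t a * w a := by
    rintro n σ hn t h3 rfl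
    rw [map_sum]
    refine Finset.sum_congr rfl fun a _ => ?_
    by_cases h : t a = 0
    · simp [h]
    · rw [map_smul, smul_eq_mul, (hn a).1 (h3 a h)]
  have key' : ∀ (n : NR) (σ : Finset MR), (∀ a, (pt a ∈ σ → n (pt a) = w a) ∧
      (pt a ∉ σ → n (pt a) < w a)) → ∀ a, n (pt a) ≤ w a := by
    intro n σ hn a
    by_cases h : pt a ∈ σ
    · exact ((hn a).1 h).le
    · exact ((hn a).2 h).le
  obtain ⟨n, hn⟩ := hw σ hσ
  obtain ⟨n', hn'⟩ := hw τ hτ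
  have e1 := key n σ hn t h3 h2
  have e2 := key n' τ hn' t' h3' h2'
  have e3 : n x = ∑ a, t' a * n (pt a) := by rw [← h2']; simp
  have e4 : n' x = ∑ a, t a * n' (pt a) := by rw [← h2]; simp
  have e5 : ∑ a, t a * n' (pt a) ≤ ∑ a, t a * w a :=
    Finset.sum_le_sum fun a _ => mul_le_mul_of_nonneg_left (key' n' τ hn' a) (h0 a)
  have e6 : ∑ a, t' a * (w a - n (pt a)) = 0 := by
    refine le_antisymm ?_ (Finset.sum_nonneg fun a _ =>
      mul_nonneg (h0' a) (sub_nonneg.2 (key' n σ hn a)))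
    simp only [mul_sub, Finset.sum_sub_distrib]
    linarith
  have h4 : ∀ a, t' a ≠ 0 → pt a ∈ σ := fun a ha => by
    have := (Finset.sum_eq_zero_iff_of_nonneg fun a _ =>
      mul_nonneg (h0' a) (sub_nonneg.2 (key' n σ hn a))).1 e6 a (Finset.mem_univ a)
    have := (mul_eq_zero.1 this).resolve_left ha
    by_contra h
    linarith [(hn a).2 h]
  obtain ⟨S, rfl⟩ := exists_image_pt_eq hZ hσ
  have hmem : ∀ a, pt a ∈ S.image pt → a ∈ S := fun a ha => by
    obtain ⟨b, hb, h⟩ := Finset.mem_image.1 ha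
    exact pt_injective h ▸ hb
  have hoff : ∀ a, a ∉ S → t a = 0 ∧ t' a = 0 := fun a ha =>
    ⟨by_contra fun h => ha (hmem a (h3 a h)), by_contra fun h => ha (hmem a (h4 a h))⟩
  have hli := linearIndepOn_finset_iff.1 (linearIndepOn_pt hZ hσ) (t - t') (by
    rw [Finset.sum_subset (Finset.subset_univ S) fun a _ ha => by
      simp [(hoff a ha).1, (hoff a ha).2]]
    simp only [Pi.sub_apply, sub_smul, Finset.sum_sub_distrib, h2, h2', sub_self])
  funext a
  by_cases ha : a ∈ S
  · exact sub_eq_zero.1 (hli a ha)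
  · rw [(hoff a ha).1, (hoff a ha).2]

theorem skeletonMap_eq (hZ : IsIntegralDecomposition Z) (hw : IsConvexCompatible Z w) {x : MR}
    {t : Delta0 → ℝ} (ht : IsBarycentricCoord Z x t) :
    skeletonMap Z w x = ∑ a, t a • dualVertex w a := by
  have hx : ∃ t, IsBarycentricCoord Z x t := ⟨t, ht⟩
  rw [skeletonMap, dif_pos hx, coord_unique hZ hw hx.choose_spec ht]
  rfl

open Classical in
theorem isBarycentricCoord_uniformWeight {S : Finset Delta0} (hS : S.image pt ∈ Z.faces) :
    IsBarycentricCoord Z (∑ a, uniformWeight S a • pt a) (uniformWeight S) :=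
  ⟨uniformWeight_nonneg S, sum_uniformWeight (Finset.image_nonempty.1 (Z.nonempty_of_mem_faces hS)),
    rfl, _, hS, fun _ ha => Finset.mem_image_of_mem pt (uniformWeight_ne_zero_iff.1 ha)⟩

open Classical in
theorem centroid_image_pt {S : Finset Delta0} (hS : S.Nonempty) :
    (S.image pt).centroid ℝ id = ∑ a, uniformWeight S a • pt a := by
  have hS' : (S.image pt).Nonempty := hS.image pt
  rw [Finset.centroid_def, Finset.affineCombination_eq_linear_combination _ _ _
    ((S.image pt).sum_centroidWeights_eq_one_of_nonempty ℝ hS'),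
    sum_uniformWeight_smul S pt]
  simp only [Finset.centroidWeights_apply, id, Finset.smul_sum]
  rw [Finset.sum_image fun a _ b _ h => pt_injective h, Finset.card_image_of_injective _ pt_injective]


variable {w : Delta0 → ℝ} {Z : Geometry.SimplicialComplex ℝ MR}

/-! ### Barycenters of dual faces -/

theorem isProperFace_dualInM (hpos : ∀ a, 0 < w a) {y : NR} (hy : y ∈ DeltaW w)
    (hne : (active w y).Nonempty) :
    IsProperFace (dualInM (DeltaW w)) {m | m ∈ dualInM (DeltaW w) ∧ y m = -1} := by
  obtain ⟨a, ha⟩ := hne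
  have hg := dualInM_DeltaW_eq_polyhedron hpos
  have hfin : Finite ((DeltaW w).extremePoints ℝ) := by
    rw [DeltaW_eq hpos]; exact (finite_extremePoints_polyhedron _).to_subtype
  have h1 : ∀ x ∈ dualInM (DeltaW w), -1 ≤ y x := fun x hx => hx y hy
  have h2 := dualVertex_mem hpos a
  rw [hg] at h1 h2 ⊢
  exact isProperFace_of_functional h1 h2 ((ell_eq_zero_iff hpos _ _).1 (mem_active.1 ha))

theorem extremePoints_dualInM_subset (hpos : ∀ a, 0 < w a) :
    (dualInM (DeltaW w)).extremePoints ℝ ⊆ Set.range (dualVertex w) := by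
  rw [dualInM_DeltaW hpos]
  exact extremePoints_convexHull_subset

open Classical in
theorem exists_active_eq_singleton (hZ : IsIntegralDecomposition Z)
    (hw : IsConvexCompatible Z w) (a : Delta0) : ∃ y ∈ DeltaW w, active w y = {a} :=
  exists_active_eq hw (by rw [Finset.image_singleton]; exact singleton_pt_mem hZ a)

theorem dualVertex_injective (hpos : ∀ a, 0 < w a) (hZ : IsIntegralDecomposition Z)
    (hw : IsConvexCompatible Z w) : Function.Injective (dualVertex w) := by
  intro a b hab
  obtain ⟨y, -, h⟩ := exists_active_eq_singleton hZ hw a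
  have ha : a ∈ active w y := by rw [h]; exact Finset.mem_singleton_self a
  have hb : b ∈ active w y := by
    rw [mem_active, ell_eq_zero_iff hpos] at ha ⊢
    rwa [← hab]
  rw [h] at hb
  exact (Finset.mem_singleton.1 hb).symm

/-- A point of `Δ_w` whose only active constraint is `a` exposes a face of the dual polytope. This
face has an extreme point, which can only be `dualVertex w a`. -/
theorem dualVertex_mem_extremePoints (hpos : ∀ a, 0 < w a) (hZ : IsIntegralDecomposition Z)
    (hw : IsConvexCompatible Z w) (a : Delta0) :
    dualVertex w a ∈ (dualInM (DeltaW w)).extremePoints ℝ := by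
  obtain ⟨y, hy, h⟩ := exists_active_eq_singleton hZ hw a
  have hF := isProperFace_dualInM hpos hy (by rw [h]; exact Finset.singleton_nonempty a)
  obtain ⟨e, he⟩ := (hF.isCompact (isCompact_dualInM_DeltaW hpos)).extremePoints_nonempty hF.1
  have heQ := hF.2.2.isExtreme.extremePoints_subset_extremePoints he
  obtain ⟨b, rfl⟩ := extremePoints_dualInM_subset hpos heQ
  have hb : b ∈ active w y := mem_active.2 ((ell_eq_zero_iff hpos _ _).2 he.1.2)
  rw [h, Finset.mem_singleton] at hb
  rwa [← hb]

theorem dualFace_DeltaW_eq (hpos : ∀ a, 0 < w a) {A : Set NR} (hA : IsProperFace (DeltaW w) A) :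
    dualFace (DeltaW w) A = {m | m ∈ dualInM (DeltaW w) ∧ barycenter A m = -1} := by
  have hc := isCompact_polyhedron_dualVertex hpos
  rw [DeltaW_eq hpos] at hA ⊢
  exact dualFace_eq hc hA

theorem extremePoints_dualFace (hpos : ∀ a, 0 < w a) (hZ : IsIntegralDecomposition Z)
    (hw : IsConvexCompatible Z w) {A : Set NR} (hA : IsProperFace (DeltaW w) A) :
    (dualFace (DeltaW w) A).extremePoints ℝ =
      dualVertex w '' (active w (barycenter A) : Set Delta0) := by
  have hF := isProperFace_dualInM hpos (hA.subset (barycenter_mem_face hpos hA))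
    (active_face_nonempty hpos hA)
  rw [dualFace_DeltaW_eq hpos hA, hF.2.2.isExtreme.extremePoints_eq]
  ext m
  constructor
  · rintro ⟨h1, h2⟩
    obtain ⟨a, rfl⟩ := extremePoints_dualInM_subset hpos h2
    exact ⟨a, mem_active.2 ((ell_eq_zero_iff hpos _ _).2 h1.2), rfl⟩
  · rintro ⟨a, ha, rfl⟩
    exact ⟨⟨dualVertex_mem hpos a, (ell_eq_zero_iff hpos _ _).1 (mem_active.1 ha)⟩,
      dualVertex_mem_extremePoints hpos hZ hw a⟩

/-- The average of vertices of the dual of `Δ_w`. -/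
def dualAverage (w : Delta0 → ℝ) (S : Finset Delta0) : MR :=
  ∑ a, uniformWeight S a • dualVertex w a

theorem barycenter_dualFace (hpos : ∀ a, 0 < w a) (hZ : IsIntegralDecomposition Z)
    (hw : IsConvexCompatible Z w) {A : Set NR} (hA : IsProperFace (DeltaW w) A) :
    barycenter (dualFace (DeltaW w) A) = dualAverage w (active w (barycenter A)) := by
  have hinj := dualVertex_injective hpos hZ hw
  rw [barycenter, extremePoints_dualFace hpos hZ hw hA, Set.ncard_image_of_injective _ hinj,
    Set.ncard_coe_finset, finsum_mem_image hinj.injOn, finsum_mem_coe_finset, dualAverage,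
    sum_uniformWeight_smul _ (dualVertex w)]

/-! ### The decomposition of the two-skeleton is pure -/

theorem finite_faces (hZ : IsIntegralDecomposition Z) : Z.faces.Finite := by
  refine ((Set.finite_range pt).finite_subsets.preimage
    (f := fun σ : Finset MR => (σ : Set MR)) Finset.coe_injective.injOn).subset fun σ hσ => ?_
  intro m hm
  exact exists_pt_eq hZ hσ hm

/-- At most three conditions, vanishing on `S` and at corner `i`, leave a nonzero functional on a
four-dimensional space. If it also vanished at every corner except the `j`-th, the zero sum of the
corners would make it zero. -/
theorem exists_functional_corner {i j : Fin 5} {S : Finset Delta0} (hS : S.card ≤ 2) :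
    ∃ n : NR, (∀ a ∈ S, n (pt a) = 0) ∧ ∃ k, k ≠ i ∧ k ≠ j ∧ n (pt (corner k)) ≠ 0 := by
  let Φ : NR →ₗ[ℝ] (S → ℝ) × ℝ := (evalOn S).prod (evalM (pt (corner i)) : NR →ₗ[ℝ] ℝ)
  have hlt : Module.finrank ℝ ((S → ℝ) × ℝ) < Module.finrank ℝ NR := by
    rw [finrank_NR, Module.finrank_prod, Module.finrank_fintype_fun_eq_card, Fintype.card_coe,
      Module.finrank_self]
    omega
  have hker := LinearMap.ker_ne_bot_of_finrank_lt (K := ℝ) (V := NR) (V₂ := (S → ℝ) × ℝ) (f := Φ) hlt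
  obtain ⟨n, hn, hn0⟩ := (Submodule.ne_bot_iff _).1 hker
  have hΦ : Φ n = 0 := hn
  have h1 : ∀ a ∈ S, n (pt a) = 0 := fun a ha => congrFun (congrArg Prod.fst hΦ) ⟨a, ha⟩
  have h2 : n (pt (corner i)) = 0 := congrArg Prod.snd hΦ
  refine ⟨n, h1, ?_⟩
  by_contra! hk
  refine hn0 (NR_ext_corner fun k => ?_)
  have hoff : ∀ k, k ≠ j → n (pt (corner k)) = 0 := fun k hkj => by
    by_cases hki : k = i
    · rw [hki, h2]
    · exact hk k hki hkj
  by_cases hkj : k = j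
  · have h0 : ∑ l, n (pt (corner l)) = 0 := by rw [← map_sum, sum_pt_corner, map_zero]
    rw [Finset.sum_eq_single j (fun l _ hl => hoff l hl)
      (fun h => (h (Finset.mem_univ j)).elim)] at h0
    rw [hkj, h0]
    rfl
  · rw [hoff k hkj]
    rfl

open Classical in
-- The barycenter `p` of `S` is moved slightly towards a corner `k` of its two-face lying off a
-- hyperplane `n = 0` through `S`. A simplex containing the new point contains `p`, hence contains
-- `S` by uniqueness of coordinates, and it differs from `S` because the new point is off the
-- hyperplane.
theorem exists_face_ssuperset (hZ : IsIntegralDecomposition Z) (hw : IsConvexCompatible Z w)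
    {S : Finset Delta0} (hS : S.image pt ∈ Z.faces) (hcard : S.card ≤ 2) :
    ∃ T : Finset Delta0, T.image pt ∈ Z.faces ∧ S ⊂ T := by
  obtain ⟨i, j, hij, hz⟩ := exists_zero_of_mem_faces hZ hS
  have hz' : ∀ a ∈ S, a.1 i = 0 ∧ a.1 j = 0 := fun a ha => hz a (Finset.mem_image_of_mem pt ha)
  obtain ⟨n, hn, k, hki, hkj, hnk⟩ := exists_functional_corner (i := i) (j := j) hcard
  have hcoord := isBarycentricCoord_uniformWeight hS
  have hSne : S.Nonempty := Finset.image_nonempty.1 (Z.nonempty_of_mem_faces hS)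
  set p := ∑ a, uniformWeight S a • pt a with hp
  set q := pt (corner k) with hq
  have hp1 : ∀ l, (∀ a ∈ S, a.1 l = 0) → p.1 l = -1 := fun l hl =>
    (combination_eq_neg_one_iff hcoord.1 hcoord.2.1 l).2 fun a ha =>
      hl a (uniformWeight_ne_zero_iff.1 ha)
  have hq1 : ∀ l, l ≠ k → q.1 l = -1 := fun l hl => by
    rw [hq, pt_corner_apply, if_neg hl]; norm_num
  have hpΔ : p ∈ Z.space := Z.convexHull_subset_space hS
    (combination_mem_convexHull hcoord.1 hcoord.2.1 fun a ha =>
      Finset.mem_image_of_mem pt (uniformWeight_ne_zero_iff.1 ha))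
  rw [hZ.1] at hpΔ
  have hnp : n p = 0 := by
    rw [hp, map_sum]
    refine Finset.sum_eq_zero fun a _ => ?_
    by_cases ha : a ∈ S
    · rw [map_smul, hn a ha, smul_zero]
    · rw [not_not.1 (mt uniformWeight_ne_zero_iff.1 ha), zero_smul, map_zero]
  have hskel : ∀ ε : ℝ, ε ∈ Set.Ioo 0 1 → p + ε • (q - p) ∈ twoSkeleton := by
    rintro ε ⟨h0, h1⟩
    have hval : ∀ l, (p + ε • (q - p)).1 l = (1 - ε) * p.1 l + ε * q.1 l := fun l => by
      simp
      ring
    refine ⟨fun l => ?_, i, j, hij, ?_, ?_⟩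
    · rw [hval]
      have h2 := hpΔ.1 l
      have h3 := neg_one_le_pt (corner k) l
      nlinarith
    · rw [hval, hp1 i fun a ha => (hz' a ha).1, hq1 i (Ne.symm hki)]; ring
    · rw [hval, hp1 j fun a ha => (hz' a ha).2, hq1 j (Ne.symm hkj)]; ring
  -- The finitely many simplices avoiding `p` have closed union, so sufficiently short moves miss
  -- them all.
  have hclosed : IsClosed (⋃ τ ∈ {τ | τ ∈ Z.faces ∧ p ∉ convexHull ℝ (τ : Set MR)},
      convexHull ℝ (τ : Set MR)) :=
    ((finite_faces hZ).subset fun _ h => h.1).isClosed_biUnion fun τ _ =>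
      (τ.finite_toSet.isCompact_convexHull ℝ).isClosed
  have hnear : ∀ᶠ ε : ℝ in nhdsWithin 0 (Set.Ioi 0), p + ε • (q - p) ∈
      (⋃ τ ∈ {τ | τ ∈ Z.faces ∧ p ∉ convexHull ℝ (τ : Set MR)}, convexHull ℝ (τ : Set MR))ᶜ := by
    have hc : Continuous fun ε : ℝ => p + ε • (q - p) := by fun_prop
    refine (hc.continuousAt.eventually_mem (hclosed.isOpen_compl.mem_nhds ?_)).filter_mono
      nhdsWithin_le_nhds
    simp only [zero_smul, add_zero, Set.mem_compl_iff, Set.mem_iUnion, exists_prop, not_exists]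
    exact fun τ h => h.1.2 h.2
  obtain ⟨ε, hε, hεI⟩ := (hnear.and (Ioo_mem_nhdsGT zero_lt_one)).exists
  have hx := hskel ε hεI
  rw [← hZ.1, Geometry.SimplicialComplex.mem_space_iff] at hx
  obtain ⟨τ, hτ, hxτ⟩ := hx
  have hpτ : p ∈ convexHull ℝ (τ : Set MR) := by
    by_contra h
    exact hε (Set.mem_biUnion (show τ ∈ {τ | τ ∈ Z.faces ∧ p ∉ convexHull ℝ (τ : Set MR)} from
      ⟨hτ, h⟩) hxτ)
  obtain ⟨t, h0, h1, h2, h3⟩ := exists_combination_of_mem_convexHull hZ hτ hpτ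
  have heq := coord_unique hZ hw hcoord ⟨h0, h1, h2, τ, hτ, h3⟩
  obtain ⟨T, rfl⟩ := exists_image_pt_eq hZ hτ
  have hST : S ⊆ T := fun a ha => by
    have h4 := h3 a (by rw [← heq]; exact uniformWeight_ne_zero_iff.2 ha)
    obtain ⟨b, hb, h⟩ := Finset.mem_image.1 h4
    exact pt_injective h ▸ hb
  refine ⟨T, hτ, hST.ssubset_of_ne ?_⟩
  rintro rfl
  have hsub : convexHull ℝ ((S.image pt : Finset MR) : Set MR) ⊆ {m | n m = 0} := by
    refine convexHull_min (fun m hm => ?_) ((convex_singleton (0 : ℝ)).linear_preimage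
      (n : MR →ₗ[ℝ] ℝ))
    obtain ⟨a, ha, rfl⟩ := Finset.mem_image.1 (Finset.mem_coe.1 hm)
    exact hn a ha
  have h5 : n (p + ε • (q - p)) = 0 := hsub hxτ
  rw [map_add, map_smul, map_sub, hnp, sub_zero, zero_add, smul_eq_mul] at h5
  exact (mul_ne_zero hεI.1.ne' hnk) h5

/-! ### The two graphs -/

open Classical in
/-- The common image of the two graphs in the boundary of the dual of `Δ_w`: the union of the
segments between the barycenters of an edge and of a triangle containing it. -/
def edgeTriangleGraph (Z : Geometry.SimplicialComplex ℝ MR) (w : Delta0 → ℝ) : Set MR :=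
  {x | ∃ S T : Finset Delta0, T.image pt ∈ Z.faces ∧ S ⊂ T ∧ 2 ≤ S.card ∧
    x ∈ segment ℝ (dualAverage w S) (dualAverage w T)}

open Classical in
-- Along the segment the active set is largest at the barycenter of `A`, and nonempty subsets of a
-- simplex are simplices, so the blow-down condition need only be tested there. The bound on
-- `faceDim B` becomes a bound on the number of active points.
theorem mem_GammaMirror_iff (hpos : ∀ a, 0 < w a) (hZ : IsIntegralDecomposition Z)
    (hw : IsConvexCompatible Z w) {x : NR} :
    x ∈ GammaMirror w ↔ ∃ A B : Set NR, IsProperFace (DeltaW w) A ∧ IsProperFace (DeltaW w) B ∧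
      A ⊂ B ∧ (active w (barycenter A)).image pt ∈ Z.faces ∧
      2 ≤ (active w (barycenter B)).card ∧ x ∈ segment ℝ (barycenter A) (barycenter B) := by
  refine exists_congr fun A => exists_congr fun B => and_congr_right fun hA =>
    and_congr_right fun hB => and_congr_right fun hAB => ?_
  have hact := (face_subset_iff hpos hA hB).1 hAB.1
  have hbA := hA.subset (barycenter_mem_face hpos hA)
  have hbB := hB.subset (barycenter_mem_face hpos hB)
  have hface : (active w (barycenter A)).image pt ∈ Z.faces →
      (active w (barycenter B)).image pt ∈ Z.faces := fun h =>
    Z.down_closed h (Finset.image_subset_image hact) ((active_face_nonempty hpos hB).image pt)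
  have hiff : (∀ y ∈ segment ℝ (barycenter A) (barycenter B),
      blowdown w y ∉ (dualInN Delta).extremePoints ℝ) ↔
      (active w (barycenter A)).image pt ∈ Z.faces := by
    constructor
    · intro h
      exact (blowdown_notMem_extremePoints_iff hpos hZ hw (barycenter_mem_frontier hpos hA)).1
        (h _ (left_mem_segment ℝ _ _))
    · rintro h y ⟨a, b, ha, hb, hab, rfl⟩
      rcases hb.eq_or_lt with hb0 | hb0
      · subst hb0
        have ha1 : a = 1 := by linarith
        rw [ha1, one_smul, zero_smul, add_zero]
        exact (blowdown_notMem_extremePoints_iff hpos hZ hw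
          (barycenter_mem_frontier hpos hA)).2 h
      · have he := active_add_smul hact hbA hbB ha hb0 hab
        have hm : a • barycenter A + b • barycenter B ∈ DeltaW w := by
          have hc : Convex ℝ (DeltaW w) := DeltaW_eq hpos ▸ convex_polyhedron _
          exact hc hbA hbB ha hb hab
        refine (blowdown_notMem_extremePoints_iff hpos hZ hw ((mem_frontier_DeltaW hpos).2
          ⟨hm, ?_⟩)).2 ?_
        · rw [he]; exact active_face_nonempty hpos hB
        · rw [he]; exact hface h
  rw [hiff]
  constructor
  · rintro ⟨h1, h2, h3⟩
    have := card_active_add_faceDim hpos hZ hB (hface h2)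
    exact ⟨h2, by omega, h3⟩
  · rintro ⟨h1, h2, h3⟩
    have := card_active_add_faceDim hpos hZ hB (hface h1)
    exact ⟨by omega, h1, h3⟩

/-- The correspondence maps the segment between the barycenters of two incident faces linearly
to the segment between the barycenters of their dual faces. -/
theorem IsDualBarycentric.apply_segment {P : Set NR} {s : frontier P ≃ₜ frontier (dualInM P)}
    (hs : IsDualBarycentric s) {A B : Set NR} (hA : IsProperFace P A) (hB : IsProperFace P B)
    (hAB : A ⊂ B) {a b : ℝ} (ha : 0 ≤ a) (hb : 0 ≤ b) (hab : a + b = 1) :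
    ∃ hx : a • barycenter A + b • barycenter B ∈ frontier P,
      (s ⟨_, hx⟩ : MR) = a • barycenter (dualFace P A) + b • barycenter (dualFace P B) := by
  classical
  have hne : A ≠ B := hAB.ne
  have hflag : IsFlag P {A, B} := by
    refine ⟨by simp, ?_, ?_⟩
    · intro C hC
      rcases Finset.mem_insert.1 hC with rfl | hC
      · exact hA
      · rwa [Finset.mem_singleton.1 hC]
    · rw [Finset.coe_pair]
      exact IsChain.pair hAB.1
  have := hs.2 {A, B} hflag (fun C => if C = A then a else b)
    (fun C _ => by split_ifs <;> assumption) (by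
      rw [Finset.sum_pair hne, if_pos rfl, if_neg hne.symm, hab])
  simp only [Finset.sum_pair hne, if_pos, if_neg hne.symm] at this
  exact this

theorem image_GammaMirror (hpos : ∀ a, 0 < w a) (hZ : IsIntegralDecomposition Z)
    (hw : IsConvexCompatible Z w) {s : frontier (DeltaW w) ≃ₜ frontier (dualInM (DeltaW w))}
    (hs : IsDualBarycentric s) :
    (fun x => (s x : MR)) '' {x | (x : NR) ∈ GammaMirror w} = edgeTriangleGraph Z w := by
  classical
  ext z
  constructor
  · rintro ⟨⟨x, hx⟩, hxG, rfl⟩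
    obtain ⟨A, B, hA, hB, hAB, hface, hcard, a, b, ha, hb, hab, hxab⟩ :=
      (mem_GammaMirror_iff hpos hZ hw).1 hxG
    change a • barycenter A + b • barycenter B = x at hxab
    subst hxab
    obtain ⟨hx', h⟩ := hs.apply_segment hA hB hAB ha hb hab
    refine ⟨active w (barycenter B), active w (barycenter A), hface, ?_, hcard,
      b, a, hb, ha, by linarith, ?_⟩
    · exact ⟨(face_subset_iff hpos hA hB).1 hAB.1,
        fun h => hAB.2 ((face_subset_iff hpos hB hA).2 h)⟩
    · rw [← barycenter_dualFace hpos hZ hw hA, ← barycenter_dualFace hpos hZ hw hB, add_comm]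
      exact h.symm
  · rintro ⟨S, T, hT, hST, hcard, a, b, ha, hb, hab, rfl⟩
    have hS : S.image pt ∈ Z.faces := Z.down_closed hT (Finset.image_subset_image hST.1)
      ((Finset.card_pos.1 (by omega)).image pt)
    obtain ⟨A, hA, rfl⟩ := exists_face_of_simplex hpos hw hT
    obtain ⟨B, hB, rfl⟩ := exists_face_of_simplex hpos hw hS
    have hAB : A ⊂ B := ⟨(face_subset_iff hpos hA hB).2 hST.1,
      fun h => hST.2 ((face_subset_iff hpos hB hA).1 h)⟩
    obtain ⟨hx, h⟩ := hs.apply_segment hA hB hAB hb ha (by linarith)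
    refine ⟨⟨_, hx⟩, (mem_GammaMirror_iff hpos hZ hw).2 ⟨A, B, hA, hB, hAB, hT, hcard,
      b, a, hb, ha, by linarith, rfl⟩, ?_⟩
    rw [← barycenter_dualFace hpos hZ hw hA, ← barycenter_dualFace hpos hZ hw hB]
    exact h.trans (add_comm _ _)

open Classical in
-- `S` and the vertex `{b}` would give coordinates of the same point, so they agree. Thus the
-- centroid condition in `GammaQuintic` excludes exactly the vertices of `Z`.
theorem card_eq_one_of_centroid_mem (hZ : IsIntegralDecomposition Z)
    (hw : IsConvexCompatible Z w) {S : Finset Delta0} (hS : S.image pt ∈ Z.faces) {b : Delta0}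
    (hb : (S.image pt).centroid ℝ id = pt b) : S.card = 1 := by
  have hSne : S.Nonempty := Finset.image_nonempty.1 (Z.nonempty_of_mem_faces hS)
  have hb' : (({b} : Finset Delta0).image pt) ∈ Z.faces := by
    rw [Finset.image_singleton]; exact singleton_pt_mem hZ b
  have h1 := isBarycentricCoord_uniformWeight hS
  have h2 := isBarycentricCoord_uniformWeight hb'
  have h3 : ∑ a, uniformWeight {b} a • pt a = ∑ a, uniformWeight S a • pt a := by
    rw [← centroid_image_pt hSne, hb, ← centroid_image_pt (Finset.singleton_nonempty b),
      Finset.image_singleton, Finset.centroid_singleton, id]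
  rw [h3] at h2
  have h4 := coord_unique hZ hw h1 h2
  have h5 : S = {b} := by
    ext a
    rw [← uniformWeight_ne_zero_iff, h4, uniformWeight_ne_zero_iff]
  rw [h5, Finset.card_singleton]

open Classical in
theorem skeletonMap_segment (hZ : IsIntegralDecomposition Z) (hw : IsConvexCompatible Z w)
    {S T : Finset Delta0} (hT : T.image pt ∈ Z.faces) (hST : S ⊆ T) (hS : S.Nonempty) {a b : ℝ}
    (ha : 0 ≤ a) (hb : 0 ≤ b) (hab : a + b = 1) :
    skeletonMap Z w (a • (S.image pt).centroid ℝ id + b • (T.image pt).centroid ℝ id) =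
      a • dualAverage w S + b • dualAverage w T := by
  have hTne := hS.mono hST
  have hcoord : IsBarycentricCoord Z
      (a • (S.image pt).centroid ℝ id + b • (T.image pt).centroid ℝ id)
      (fun c => a * uniformWeight S c + b * uniformWeight T c) := by
    refine ⟨fun c => ?_, ?_, ?_, _, hT, fun c hc => ?_⟩
    · have := uniformWeight_nonneg S c
      have := uniformWeight_nonneg T c
      positivity
    · rw [Finset.sum_add_distrib, ← Finset.mul_sum, ← Finset.mul_sum, sum_uniformWeight hS,
        sum_uniformWeight hTne, mul_one, mul_one, hab]
    · rw [centroid_image_pt hS, centroid_image_pt hTne]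
      simp only [add_smul, mul_smul, Finset.sum_add_distrib, Finset.smul_sum]
    · by_contra hn
      have hcT : c ∉ T := fun h => hn (Finset.mem_image_of_mem pt h)
      have hcS : c ∉ S := fun h => hcT (hST h)
      refine hc ?_
      dsimp only
      rw [not_not.1 (mt uniformWeight_ne_zero_iff.1 hcT),
        not_not.1 (mt uniformWeight_ne_zero_iff.1 hcS), mul_zero, mul_zero, add_zero]
  rw [skeletonMap_eq hZ hw hcoord, dualAverage, dualAverage]
  simp only [add_smul, mul_smul, Finset.sum_add_distrib, Finset.smul_sum]

open Classical in
/-- A chain of edges and triangles of `Z` is contained in a flag of an edge and a triangle. -/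
theorem exists_edge_triangle (hZ : IsIntegralDecomposition Z) (hw : IsConvexCompatible Z w)
    {c : Finset (Finset MR)} (hne : c.Nonempty) (hc : ∀ σ ∈ c, σ ∈ Z.faces)
    (hch : IsChain (· ⊆ ·) (c : Set (Finset MR)))
    (hcen : ∀ σ ∈ c, σ.centroid ℝ id ∉ Set.range pt) :
    ∃ S T : Finset Delta0, T.image pt ∈ Z.faces ∧ S ⊂ T ∧ 2 ≤ S.card ∧
      ∀ σ ∈ c, σ = S.image pt ∨ σ = T.image pt := by
  have hcardim : ∀ S : Finset Delta0, (S.image pt).card = S.card := fun S =>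
    Finset.card_image_of_injective S pt_injective
  have hcard : ∀ σ ∈ c, 2 ≤ σ.card ∧ σ.card ≤ 3 := by
    intro σ hσ
    obtain ⟨S, rfl⟩ := exists_image_pt_eq hZ (hc σ hσ)
    have h1 := card_le_three hZ (hc _ hσ)
    have h2 : 0 < S.card :=
      Finset.card_pos.2 (Finset.image_nonempty.1 (Z.nonempty_of_mem_faces (hc _ hσ)))
    rw [hcardim]
    refine ⟨?_, h1⟩
    by_contra hlt
    obtain ⟨b, hb⟩ := Finset.card_eq_one.1 (show S.card = 1 by omega)
    refine hcen _ hσ ⟨b, ?_⟩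
    rw [hb, Finset.image_singleton, Finset.centroid_singleton, id]
  have hsame : ∀ σ ∈ c, ∀ τ ∈ c, σ.card = τ.card → σ = τ := by
    intro σ hσ τ hτ h
    rcases hch.total hσ hτ with h1 | h1
    · exact Finset.eq_of_subset_of_card_le h1 h.ge
    · exact (Finset.eq_of_subset_of_card_le h1 h.le).symm
  by_cases h3 : ∃ τ ∈ c, τ.card = 3
  · obtain ⟨τ, hτ, hτ3⟩ := h3
    obtain ⟨T, rfl⟩ := exists_image_pt_eq hZ (hc τ hτ)
    rw [hcardim] at hτ3
    by_cases h2 : ∃ ρ ∈ c, ρ.card = 2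
    · obtain ⟨ρ, hρ, hρ2⟩ := h2
      obtain ⟨S, rfl⟩ := exists_image_pt_eq hZ (hc ρ hρ)
      rw [hcardim] at hρ2
      have hsub : S.image pt ⊆ T.image pt := by
        rcases hch.total hρ hτ with h | h
        · exact h
        · have := Finset.card_le_card h
          rw [hcardim, hcardim] at this
          omega
      refine ⟨S, T, hc _ hτ, ⟨(Finset.image_subset_image_iff pt_injective).1 hsub, fun h => ?_⟩,
        hρ2.ge, fun σ hσ => ?_⟩
      · have := Finset.card_le_card h
        omega
      · have := hcard σ hσ
        rcases (show σ.card = 2 ∨ σ.card = 3 by omega) with h | h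
        · exact Or.inl (hsame _ hσ _ hρ (by rw [h, hcardim, hρ2]))
        · exact Or.inr (hsame _ hσ _ hτ (by rw [h, hcardim, hτ3]))
    -- The chain is a single triangle, and any of its edges completes the pair.
    · obtain ⟨S, hST, hS2⟩ := Finset.exists_subset_card_eq (show 2 ≤ T.card by omega)
      refine ⟨S, T, hc _ hτ, ⟨hST, fun h => ?_⟩, hS2.ge, fun σ hσ => Or.inr ?_⟩
      · have := Finset.card_le_card h
        omega
      · have := hcard σ hσ
        have h2' : σ.card ≠ 2 := fun h => h2 ⟨σ, hσ, h⟩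
        exact hsame _ hσ _ hτ (by rw [hcardim, hτ3]; omega)
  · obtain ⟨ρ, hρ⟩ := hne
    have hall : ∀ σ ∈ c, σ.card = 2 := fun σ hσ => by
      have := hcard σ hσ
      have h3' : σ.card ≠ 3 := fun h => h3 ⟨σ, hσ, h⟩
      omega
    obtain ⟨S, rfl⟩ := exists_image_pt_eq hZ (hc ρ hρ)
    have hS2 : S.card = 2 := by rw [← hcardim]; exact hall _ hρ
    -- The chain is a single edge; purity of `Z` supplies a triangle.
    obtain ⟨T, hT, hST⟩ := exists_face_ssuperset hZ hw (hc _ hρ) hS2.le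
    exact ⟨S, T, hT, hST, hS2.ge, fun σ hσ =>
      Or.inl (hsame _ hσ _ hρ (by rw [hall σ hσ, hall _ hρ]))⟩

theorem image_GammaQuintic (hZ : IsIntegralDecomposition Z) (hw : IsConvexCompatible Z w) :
    skeletonMap Z w '' GammaQuintic Z = edgeTriangleGraph Z w := by
  classical
  ext z
  constructor
  · rintro ⟨x, ⟨c, hne, hc, hch, hcen, hx⟩, rfl⟩
    obtain ⟨S, T, hT, hST, hcard, hcST⟩ := exists_edge_triangle hZ hw hne hc hch hcen
    have hx' : x ∈ segment ℝ ((S.image pt).centroid ℝ id) ((T.image pt).centroid ℝ id) := by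
      rw [← convexHull_pair]
      refine convexHull_mono ?_ hx
      rintro _ ⟨σ, hσ, rfl⟩
      rcases hcST σ hσ with rfl | rfl
      · exact Or.inl rfl
      · exact Or.inr rfl
    obtain ⟨a, b, ha, hb, hab, rfl⟩ := hx'
    exact ⟨S, T, hT, hST, hcard, a, b, ha, hb, hab,
      (skeletonMap_segment hZ hw hT hST.1 (Finset.card_pos.1 (by omega)) ha hb hab).symm⟩
  · rintro ⟨S, T, hT, hST, hcard, a, b, ha, hb, hab, rfl⟩
    have hSne : S.Nonempty := Finset.card_pos.1 (by omega)
    have hS : S.image pt ∈ Z.faces :=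
      Z.down_closed hT (Finset.image_subset_image hST.1) (hSne.image pt)
    have hcT := Finset.card_lt_card hST
    refine ⟨_, ⟨{S.image pt, T.image pt}, by simp, ?_, ?_, ?_, ?_⟩,
      skeletonMap_segment hZ hw hT hST.1 hSne ha hb hab⟩
    · intro σ hσ
      rcases Finset.mem_insert.1 hσ with rfl | hσ
      · exact hS
      · rwa [Finset.mem_singleton.1 hσ]
    · rw [Finset.coe_pair]
      exact IsChain.pair (Finset.image_subset_image hST.1)
    · rintro σ hσ ⟨b, hb⟩
      rcases Finset.mem_insert.1 hσ with rfl | hσ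
      · have := card_eq_one_of_centroid_mem hZ hw hS hb.symm
        omega
      · rw [Finset.mem_singleton.1 hσ] at hb
        have := card_eq_one_of_centroid_mem hZ hw hT hb.symm
        omega
    · rw [Finset.coe_pair, Set.image_pair, convexHull_pair]
      exact ⟨a, b, ha, hb, hab, rfl⟩

theorem GammaMirror_subset_frontier
    {s : frontier (DeltaW w) ≃ₜ frontier (dualInM (DeltaW w))} (hs : IsDualBarycentric s) :
    GammaMirror w ⊆ frontier (DeltaW w) := by
  rintro x ⟨A, B, hA, hB, hAB, -, -, a, b, ha, hb, hab, rfl⟩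
  exact (hs.apply_segment hA hB hAB ha hb hab).1

end QuinticMirror

end

theorem mainTheorem5 (Z : Geometry.SimplicialComplex ℝ QuinticMirror.MR)
    (hZ : QuinticMirror.IsIntegralDecomposition Z)
    (w : QuinticMirror.Delta0 → ℝ) (hpos : ∀ a, 0 < w a)
    (hw : QuinticMirror.IsConvexCompatible Z w) :
    ∃ s : frontier (QuinticMirror.DeltaW w) ≃ₜ
        frontier (QuinticMirror.dualInM (QuinticMirror.DeltaW w)),
      QuinticMirror.IsPiecewiseLinear s ∧
      QuinticMirror.IsDualBarycentric s ∧
      QuinticMirror.GammaMirror w ⊆ frontier (QuinticMirror.DeltaW w) ∧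
      (fun x => (s x : QuinticMirror.MR)) ''
          {x | (x : QuinticMirror.NR) ∈ QuinticMirror.GammaMirror w} =
        QuinticMirror.skeletonMap Z w '' QuinticMirror.GammaQuintic Z := by
  obtain ⟨s, h1, h2⟩ := QuinticMirror.exists_dualBarycentric_homeomorph hpos
  refine ⟨s, h1, h2, QuinticMirror.GammaMirror_subset_frontier h2, ?_⟩
  rw [QuinticMirror.image_GammaMirror hpos hZ hw h2, QuinticMirror.image_GammaQuintic hZ hw]
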